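/- Let $(S,\mathfrak A,\mu)$ and $(T,\mathfrak B,\nu)$ be $\sigma$-finite measure spaces. For $h\in L^2(\mu\times\nu)$ let $\mathcal I_h:L^2(\nu)\to L^2(\mu)$ be the integral operator $(\mathcal I_hf)(s)=\int_T h(s,t)f(t)\,d\nu(t)$. Let $\boldsymbol S_1$ be the trace class of operators from $L^2(\nu)$ to $L^2(\mu)$, with norm $\|A\|_{\boldsymbol S_1}=\operatorname{trace}\,(A^*A)^{1/2}$. A function $\Phi:S\times T\to\mathbb C$ is a Schur multiplier with respect to $\mu$ and $\nu$, written $\Phi\in\mathfrak M(\mu,\nu)$, if it is $\mu\times\nu$-measurable and, for every $h\in L^2(\mu\times\nu)$ with $\mathcal I_h\in\boldsymbol S_1$, one has $\Phi h\in L^2(\mu\times\nu)$ and $\mathcal I_{\Phi h}\in\boldsymbol S_1$. Its norm $\|\Phi\|_{\mathfrak M(\mu,\nu)}$ is the least $c\ge0$ such that $\|\mathcal I_{\Phi h}\|_{\boldsymbol S_1}\le c\,\|\mathcal I_h\|_{\boldsymbol S_1}$ for all such $h$. (a) Let $\Phi\in L^\infty(\mu\times\nu)$ and let $C>0$ be a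 real number. The following are equivalent: (i) $\Phi\in\mathfrak M(\mu,\nu)$ and $\|\Phi\|_{\mathfrak M(\mu,\nu)}\le C$; (ii) there exist a complex Hilbert space $\mathscr H$ and (strongly measurable) functions $x\in L^\infty(\mu,\mathscr H)$, $y\in L^\infty(\nu,\mathscr H)$ such that $\Phi(s,t)=\langle x(s),y(t)\rangle$ for $\mu\times\nu$-almost all $(s,t)$ and $\|x\|_{L^\infty(\mu,\mathscr H)}\,\|y\|_{L^\infty(\nu,\mathscr H)}\le C$; (iii) there exist $\varphi_n\in L^\infty(\mu)$ and $\psi_n\in L^\infty(\nu)$, $n\ge1$, such that $\Phi(s,t)=\sum_{n=1}^\infty\varphi_n(s)\psi_n(t)$ for $\mu\times\nu$-almost all $(s,t)$, $\sum_{n=1}^\infty|\varphi_n|^2\le C$ $\mu$-almost everywhere, and $\sum_{n=1}^\infty|\psi_n|^2\le C$ $\nu$-almost everywhere. (b) Let the Haagerup tensor product $L^\infty(\mu)\otimes_{\rm h}L^\infty(\nu)$ be the space of functions $\Phi$ on $S\times T$ that admit a representation $\Phi(s,t)=\sum_{n}\varphi_n(s)\psi_n(t)$ $\mu\times\nu$-almost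 everywhere with $\varphi_n\in L^\infty(\mu)$, $\psi_n\in L^\infty(\nu)$ and $\big\|\sum_n|\varphi_n|^2\big\|_{L^\infty(\mu)}<\infty$, $\big\|\sum_n|\psi_n|^2\big\|_{L^\infty(\nu)}<\infty$, and let its norm be the infimum of $\big\|\sum_n|\varphi_n|^2\big\|_{L^\infty(\mu)}^{1/2}\big\|\sum_n|\psi_n|^2\big\|_{L^\infty(\nu)}^{1/2}$ over all such representations. Then $\mathfrak M(\mu,\nu)=L^\infty(\mu)\otimes_{\rm h}L^\infty(\nu)$, and $\|\Phi\|_{\mathfrak M(\mu,\nu)}=\|\Phi\|_{L^\infty(\mu)\otimes_{\rm h}L^\infty(\nu)}$ for every $\Phi\in\mathfrak M(\mu,\nu)$. -/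

import Mathlib

open MeasureTheory
open scoped ENNReal NNReal

universe u v w

noncomputable section

/-! ### Trace class operators between Hilbert spaces -/

section TraceClass

variable {E : Type*} [NormedAddCommGroup E] [InnerProductSpace ℂ E] [CompleteSpace E]
  {F : Type*} [NormedAddCommGroup F] [InnerProductSpace ℂ F] [CompleteSpace F]

/-- The modulus `|A| = (A* A)^{1/2}` of a bounded operator between Hilbert spaces. -/
def operatorModulus (A : E →L[ℂ] F) : E →L[ℂ] E :=
  CFC.sqrt ((ContinuousLinearMap.adjoint A) ∘L A)

variable (E) in
/-- The index set of an orthonormal basis of a Hilbert space. -/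
def onbIndex : Set E := (exists_hilbertBasis ℂ E).choose

variable (E) in
/-- An orthonormal basis of a Hilbert space. -/
def onb : HilbertBasis (onbIndex E) ℂ E := (exists_hilbertBasis ℂ E).choose_spec.choose

/-- The trace norm `trace |A| = ∑ ⟨|A| e, e⟩`, the sum being over an orthonormal basis; it takes
the value `∞` when `A` is not of trace class. -/
def traceNorm (A : E →L[ℂ] F) : ℝ≥0∞ :=
  ∑' i, ENNReal.ofReal (RCLike.re (inner ℂ (operatorModulus A (onb E i)) (onb E i)))

/-- `A` belongs to the trace class `S₁`. -/
def IsTraceClass (A : E →L[ℂ] F) : Prop := traceNorm A < ∞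

end TraceClass

/-! ### Integral operators with square integrable kernels -/

section Kernel

variable {S : Type u} {T : Type v} [MeasurableSpace S] [MeasurableSpace T]
  {μ : Measure S} {ν : Measure T} [SigmaFinite μ] [SigmaFinite ν]

/-- The function `s ↦ ∫ h(s,t) f(t) dν(t)`. -/
def kernelIntegral (ν : Measure T) (h : S × T → ℂ) (f : T → ℂ) (s : S) : ℂ :=
  ∫ t, h (s, t) * f t ∂ν

lemma kernel_section_memLp {h : S × T → ℂ} (hh : MemLp h 2 (μ.prod ν)) :
    ∀ᵐ s ∂μ, MemLp (fun t => h (s, t)) 2 ν := by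
  have h1 := (memLp_two_iff_integrable_sq_norm hh.1).1 hh
  filter_upwards [h1.prod_right_ae, hh.1.prodMk_left] with s hs hs'
  exact (memLp_two_iff_integrable_sq_norm hs').2 hs

lemma kernelIntegral_aestronglyMeasurable {h : S × T → ℂ} (hh : MemLp h 2 (μ.prod ν))
    {f : T → ℂ} (hf : MemLp f 2 ν) : AEStronglyMeasurable (kernelIntegral ν h f) μ :=
  (hh.1.mul hf.1.comp_snd).integral_prod_right'

lemma enorm_kernelIntegral_le {h : S × T → ℂ} {f : T → ℂ} (hf : MemLp f 2 ν) {s : S}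
    (hs : MemLp (fun t => h (s, t)) 2 ν) :
    ‖kernelIntegral ν h f s‖ₑ ≤ eLpNorm (fun t => h (s, t)) 2 ν * eLpNorm f 2 ν := by
  refine (enorm_integral_le_lintegral_enorm _).trans ?_
  rw [← eLpNorm_one_eq_lintegral_enorm]
  have key := eLpNorm_smul_le_mul_eLpNorm (p := 2) (q := 2) (r := 1) hf.1 hs.1
  have heq : (fun t => h (s, t)) • f = fun t => h (s, t) * f t := rfl
  rwa [heq] at key

lemma eLpNorm_two_sq {α : Type*} [MeasurableSpace α] (m : Measure α) (g : α → ℂ) :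
    eLpNorm g 2 m ^ 2 = ∫⁻ a, ‖g a‖ₑ ^ 2 ∂m := by
  simpa using eLpNorm_nnreal_pow_eq_lintegral (μ := m) (f := g) (p := 2) two_ne_zero

lemma eLpNorm_kernelIntegral_le {h : S × T → ℂ} (hh : MemLp h 2 (μ.prod ν))
    {f : T → ℂ} (hf : MemLp f 2 ν) :
    eLpNorm (kernelIntegral ν h f) 2 μ ≤ eLpNorm h 2 (μ.prod ν) * eLpNorm f 2 ν := by
  rw [← ENNReal.pow_le_pow_left_iff two_ne_zero, mul_pow, eLpNorm_two_sq, eLpNorm_two_sq,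
    lintegral_prod _ (hh.1.enorm.pow_const 2), ← lintegral_mul_const' _ _ (by
      exact ENNReal.pow_ne_top hf.2.ne)]
  refine lintegral_mono_ae ?_
  filter_upwards [kernel_section_memLp hh] with s hs
  have := pow_le_pow_left' (enorm_kernelIntegral_le hf hs) 2
  rwa [mul_pow, eLpNorm_two_sq ν (fun t => h (s, t))] at this

lemma kernelIntegral_memLp {h : S × T → ℂ} (hh : MemLp h 2 (μ.prod ν))
    {f : T → ℂ} (hf : MemLp f 2 ν) : MemLp (kernelIntegral ν h f) 2 μ :=
  ⟨kernelIntegral_aestronglyMeasurable hh hf,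
    (eLpNorm_kernelIntegral_le hh hf).trans_lt (ENNReal.mul_lt_top hh.2 hf.2)⟩

/-- The integral operator `I_h : L²(ν) → L²(μ)`, `(I_h f)(s) = ∫ h(s,t) f(t) dν(t)`,
with kernel `h ∈ L²(μ × ν)`. -/
def integralOperator (h : S × T → ℂ) (hh : MemLp h 2 (μ.prod ν)) :
    Lp ℂ 2 ν →L[ℂ] Lp ℂ 2 μ :=
  LinearMap.mkContinuous
    { toFun := fun f => (kernelIntegral_memLp hh (Lp.memLp f)).toLp _
      map_add' := by
        intro f g
        rw [← MemLp.toLp_add, MemLp.toLp_eq_toLp_iff]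
        filter_upwards [kernel_section_memLp hh] with s hs
        simp only [kernelIntegral, Pi.add_apply]
        refine Eq.trans (integral_congr_ae ?_)
          (integral_add (hs.integrable_mul (Lp.memLp f)) (hs.integrable_mul (Lp.memLp g)))
        filter_upwards [Lp.coeFn_add f g] with t ht
        simp only [ht, Pi.add_apply]
        ring
      map_smul' := by
        intro c f
        rw [RingHom.id_apply, ← MemLp.toLp_const_smul, MemLp.toLp_eq_toLp_iff]
        refine Filter.Eventually.of_forall fun s => ?_
        simp only [kernelIntegral, Pi.smul_apply, smul_eq_mul]
        rw [← integral_const_mul]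
        refine integral_congr_ae ?_
        filter_upwards [Lp.coeFn_smul c f] with t ht
        rw [ht, Pi.smul_apply, smul_eq_mul]
        ring }
    (eLpNorm h 2 (μ.prod ν)).toReal (by
      intro f
      simp only [LinearMap.coe_mk, AddHom.coe_mk, Lp.norm_toLp]
      rw [Lp.norm_def, ← ENNReal.toReal_mul]
      exact ENNReal.toReal_mono (ENNReal.mul_lt_top hh.2 (Lp.memLp f).2).ne
        (eLpNorm_kernelIntegral_le hh (Lp.memLp f)))

/-! ### Schur multipliers with respect to measures -/

/-- `Φ` is a Schur multiplier with respect to `μ` and `ν`: it is `μ × ν`-measurable, and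
`I_{Φ h}` is of trace class whenever `h ∈ L²(μ × ν)` and `I_h` is of trace class. -/
def IsSchurMultiplier (μ : Measure S) (ν : Measure T) [SigmaFinite μ] [SigmaFinite ν]
    (Φ : S × T → ℂ) : Prop :=
  AEStronglyMeasurable Φ (μ.prod ν) ∧
    ∀ (h : S × T → ℂ) (hh : MemLp h 2 (μ.prod ν)), IsTraceClass (integralOperator h hh) →
      ∃ hΦ : MemLp (fun p => Φ p * h p) 2 (μ.prod ν),
        IsTraceClass (integralOperator (fun p => Φ p * h p) hΦ)

/-- `‖I_{Φ h}‖_{S₁} ≤ c ‖I_h‖_{S₁}` for all `h ∈ L²(μ × ν)` with `I_h` of trace class. -/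
def IsSchurBound (μ : Measure S) (ν : Measure T) [SigmaFinite μ] [SigmaFinite ν]
    (Φ : S × T → ℂ) (c : ℝ≥0) : Prop :=
  ∀ (h : S × T → ℂ) (hh : MemLp h 2 (μ.prod ν)), IsTraceClass (integralOperator h hh) →
    ∃ hΦ : MemLp (fun p => Φ p * h p) 2 (μ.prod ν),
      traceNorm (integralOperator (fun p => Φ p * h p) hΦ)
        ≤ c * traceNorm (integralOperator h hh)

/-- The norm of `Φ` in the space of Schur multipliers with respect to `μ` and `ν`: the least
constant `c ≥ 0` with `‖I_{Φ h}‖_{S₁} ≤ c ‖I_h‖_{S₁}` (`∞` if there is none). -/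
def schurNorm (μ : Measure S) (ν : Measure T) [SigmaFinite μ] [SigmaFinite ν]
    (Φ : S × T → ℂ) : ℝ≥0∞ :=
  ⨅ (c : ℝ≥0) (_ : IsSchurBound μ ν Φ c), (c : ℝ≥0∞)

/-! ### The Haagerup tensor product of `L^∞` spaces -/

/-- The norm of a sequence of functions in `L^∞(μ, ℓ²)`, i.e. `‖∑ |φ_n|²‖_{L^∞(μ)}^{1/2}`. -/
def normLinftyEllTwo (μ : Measure S) (φ : ℕ → S → ℂ) : ℝ≥0∞ :=
  (essSup (fun s => ∑' n, ‖φ n s‖ₑ ^ 2) μ) ^ (1 / 2 : ℝ)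

/-- `Φ(s,t) = ∑ φ_n(s) ψ_n(t)` almost everywhere, with `φ_n ∈ L^∞(μ)`, `ψ_n ∈ L^∞(ν)`,
`{φ_n} ∈ L^∞(μ, ℓ²)` and `{ψ_n} ∈ L^∞(ν, ℓ²)`. -/
structure IsHaagerupRepresentation (μ : Measure S) (ν : Measure T) (Φ : S × T → ℂ)
    (φ : ℕ → S → ℂ) (ψ : ℕ → T → ℂ) : Prop where
  left_memLp : ∀ n, MemLp (φ n) ∞ μ
  right_memLp : ∀ n, MemLp (ψ n) ∞ ν
  left_finite : normLinftyEllTwo μ φ < ∞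
  right_finite : normLinftyEllTwo ν ψ < ∞
  hasSum : ∀ᵐ p ∂(μ.prod ν), HasSum (fun n => φ n p.1 * ψ n p.2) (Φ p)

/-- Membership in the Haagerup tensor product of `L^∞(μ)` and `L^∞(ν)`. -/
def MemHaagerup (μ : Measure S) (ν : Measure T) (Φ : S × T → ℂ) : Prop :=
  ∃ (φ : ℕ → S → ℂ) (ψ : ℕ → T → ℂ), IsHaagerupRepresentation μ ν Φ φ ψ

/-- The norm in the Haagerup tensor product: the infimum of
`‖{φ_n}‖_{L^∞(μ, ℓ²)} ‖{ψ_n}‖_{L^∞(ν, ℓ²)}` over all representations. -/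
def haagerupNorm (μ : Measure S) (ν : Measure T) (Φ : S × T → ℂ) : ℝ≥0∞ :=
  ⨅ (φ : ℕ → S → ℂ) (ψ : ℕ → T → ℂ) (_ : IsHaagerupRepresentation μ ν Φ φ ψ),
    normLinftyEllTwo μ φ * normLinftyEllTwo ν ψ

end Kernel

end

/-!
A representation `Φ(s,t) = ∑ φₙ(s) ψₙ(t)` makes `Φ` a multiplier because a trace class kernel has a
nuclear expansion, and multiplying each rank-one term `f ⊗ g` by `Φ` yields `∑ φₙ f ⊗ ψₙ g`, whose
trace norm is controlled by the Cauchy–Schwarz inequality.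

Conversely, duality between trace class and bounded operators, tested on step functions, bounds the
multiplier of a matrix of averages of `Φ` over a finite grid. Separating convex cones turns such a
bound into a factorization of the matrix through a Hilbert space with vectors of norm at most
`√C`. An ultraproduct over all grids gives bounded operators `X` and `Y` from `L²` into a Hilbert
space with `⟪Y 1_B, X 1_A⟫ = ∫_{A × B} Φ`. Expanding the pairing along a countable suborthonormal
sequence gives the functions `φₙ` and `ψₙ`. A representation by Hilbert-space-valued functions is
the same thing, because their essential ranges are separable, and part (b) follows by rescaling.
-/

open Filter Function
open scoped Topology InnerProductSpace

section ENNRealSums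

variable {ι : Type*}

lemma sq_rpow_half (a : ℝ≥0∞) : (a ^ (1 / 2 : ℝ)) ^ 2 = a := by
  rw [← ENNReal.rpow_natCast, ← ENNReal.rpow_mul]
  norm_num

lemma coe_sqrt_sq (C : ℝ≥0) : ((NNReal.sqrt C : ℝ≥0) : ℝ≥0∞) ^ 2 = C := by
  rw [← ENNReal.coe_pow, NNReal.sq_sqrt]

lemma tsum_mul_le_mul_of_tsum_sq_le {f g : ι → ℝ≥0∞} {a b : ℝ≥0∞}
    (hf : ∑' i, f i ^ 2 ≤ a ^ 2) (hg : ∑' i, g i ^ 2 ≤ b ^ 2) : ∑' i, f i * g i ≤ a * b := by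
  rw [ENNReal.tsum_eq_iSup_sum]
  refine iSup_le fun s => (ENNReal.inner_le_Lp_mul_Lq s f g Real.HolderConjugate.two_two).trans ?_
  have rpow_sum_le {k : ι → ℝ≥0∞} {c : ℝ≥0∞} (hk : ∑' i, k i ^ 2 ≤ c ^ 2) :
      (∑ i ∈ s, k i ^ (2 : ℝ)) ^ (1 / 2 : ℝ) ≤ c := by
    rw [← ENNReal.pow_le_pow_left_iff two_ne_zero, sq_rpow_half]
    simp only [ENNReal.rpow_two]
    exact (ENNReal.sum_le_tsum s).trans hk
  exact mul_le_mul' (rpow_sum_le hf) (rpow_sum_le hg)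

lemma tsum_mul_le_of_tsum_sq_le {f g : ι → ℝ≥0∞} {c : ℝ≥0∞}
    (hf : ∑' i, f i ^ 2 ≤ c) (hg : ∑' i, g i ^ 2 ≤ c) : ∑' i, f i * g i ≤ c := by
  rw [← sq_rpow_half c] at hf hg
  exact (tsum_mul_le_mul_of_tsum_sq_le hf hg).trans_eq (by rw [← sq, sq_rpow_half])

end ENNRealSums

section HilbertSpace

variable {𝕜 : Type*} [RCLike 𝕜]
  {E : Type*} [NormedAddCommGroup E] [InnerProductSpace 𝕜 E]
  {F : Type*} [NormedAddCommGroup F] [InnerProductSpace 𝕜 F]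
  {G : Type*} [NormedAddCommGroup G] [InnerProductSpace 𝕜 G]

lemma enorm_inner_symm (x y : E) : ‖⟪x, y⟫_𝕜‖ₑ = ‖⟪y, x⟫_𝕜‖ₑ := by
  rw [← inner_conj_symm, RCLike.enorm_conj]

lemma enorm_lp_two_sq {ι : Type*} {V : ι → Type*} [∀ i, NormedAddCommGroup (V i)] (x : lp V 2) :
    ‖x‖ₑ ^ 2 = ∑' i, ‖x i‖ₑ ^ 2 := by
  have hasSum := lp.hasSum_norm (p := 2) (by norm_num) x
  simp only [ENNReal.toReal_ofNat, Real.rpow_ofNat] at hasSum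
  simp only [← ofReal_norm, ← ENNReal.ofReal_pow (norm_nonneg _)]
  rw [← ENNReal.ofReal_tsum_of_nonneg (fun _ => sq_nonneg _) hasSum.summable, hasSum.tsum_eq]

lemma tsum_enorm_sq_inner_hilbertBasis {ι : Type*} (b : HilbertBasis ι 𝕜 E) (x : E) :
    ∑' i, ‖⟪b i, x⟫_𝕜‖ₑ ^ 2 = ‖x‖ₑ ^ 2 := by
  simp only [← b.repr_apply_apply, ← enorm_lp_two_sq, LinearIsometryEquiv.enorm_map]

/-- An operator dominated by `R` factors through `R` (Douglas): it extends to the closure of the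
range of `R`, and by zero to the orthogonal complement. -/
lemma exists_comp_eq_of_norm_apply_le [CompleteSpace F] [CompleteSpace G] {R : E →L[𝕜] F}
    {B : E →L[𝕜] G} (h : ∀ x, ‖B x‖ ≤ ‖R x‖) : ∃ W : F →L[𝕜] G, ‖W‖ ≤ 1 ∧ ∀ x, W (R x) = B x := by
  let K : Submodule 𝕜 F := R.range.topologicalClosure
  have : CompleteSpace K := R.range.isClosed_topologicalClosure.completeSpace_coe
  let e : E →ₗ[𝕜] K := R.toLinearMap.codRestrict K fun x =>
    Submodule.le_topologicalClosure _ ⟨x, rfl⟩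
  have dense_e : DenseRange e :=
    ((denseRange_inclusion_iff subset_closure).2 subset_rfl).comp
      R.toLinearMap.surjective_rangeRestrict.denseRange
        (continuous_inclusion R.range.le_topologicalClosure)
  have norm_le : ∀ x, ‖B.toLinearMap x‖ ≤ 1 * ‖e x‖ := fun x => (h x).trans_eq (one_mul _).symm
  let W₀ : K →L[𝕜] G := B.toLinearMap.extendOfNorm e
  have norm_W₀ : ‖W₀‖ ≤ 1 := LinearMap.opNorm_extendOfNorm_le dense_e zero_le_one norm_le
  refine ⟨W₀ ∘L K.orthogonalProjectionOnto, ?_, fun x => ?_⟩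
  · exact (W₀.opNorm_comp_le _).trans
      (mul_le_one₀ norm_W₀ (norm_nonneg _) K.orthogonalProjectionOnto_norm_le)
  · exact (congrArg W₀ (K.orthogonalProjectionOnto_mem_subspace_eq_self (e x))).trans
      (LinearMap.extendOfNorm_eq dense_e ⟨1, norm_le⟩ x)

/-- A nuclear expansion `A = ∑ ⟨v_k, ·⟩ u_k`, convergent in the weak sense: the infimum of
`∑ ‖u_k‖ ‖v_k‖` over these is the trace norm. -/
def IsNuclearExpansion {ι : Type*} (A : E →L[𝕜] F) (u : ι → F) (v : ι → E) : Prop :=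
  ∀ x y, HasSum (fun k => ⟪v k, x⟫_𝕜 * ⟪y, u k⟫_𝕜) ⟪y, A x⟫_𝕜

end HilbertSpace

section TraceNorm

variable {E : Type*} [NormedAddCommGroup E] [InnerProductSpace ℂ E] [CompleteSpace E]
  {F : Type*} [NormedAddCommGroup F] [InnerProductSpace ℂ F] [CompleteSpace F]

lemma inner_sqrt_apply_sqrt_apply {A : E →L[ℂ] E} (hA : 0 ≤ A) (x y : E) :
    ⟪CFC.sqrt A x, CFC.sqrt A y⟫_ℂ = ⟪x, A y⟫_ℂ := by
  rw [← ContinuousLinearMap.adjoint_inner_right, (CFC.sqrt_nonneg A).isSelfAdjoint.adjoint_eq,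
    ← mul_apply_eq_comp, CFC.sqrt_mul_sqrt_self A hA]

lemma norm_operatorModulus_apply (A : E →L[ℂ] F) (x : E) : ‖operatorModulus A x‖ = ‖A x‖ := by
  have adjoint_comp_nonneg : 0 ≤ A.adjoint ∘L A :=
    (ContinuousLinearMap.nonneg_iff_isPositive _).2 A.isPositive_adjoint_comp_self
  rw [@norm_eq_sqrt_re_inner ℂ, @norm_eq_sqrt_re_inner ℂ, operatorModulus,
    inner_sqrt_apply_sqrt_apply adjoint_comp_nonneg, ContinuousLinearMap.comp_apply,
    ContinuousLinearMap.adjoint_inner_right]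

lemma IsNuclearExpansion.traceNorm_le {ι : Type*} {A : E →L[ℂ] F} {u : ι → F} {v : ι → E}
    (h : IsNuclearExpansion A u v) : traceNorm A ≤ ∑' k, ‖u k‖ₑ * ‖v k‖ₑ := by
  obtain ⟨W, norm_W, hW⟩ :=
    exists_comp_eq_of_norm_apply_le fun x => (norm_operatorModulus_apply A x).le
  have diagonal_le (i : onbIndex E) :
      ENNReal.ofReal (RCLike.re ⟪operatorModulus A (onb E i), onb E i⟫_ℂ) ≤
        ∑' k, ‖⟪onb E i, v k⟫_ℂ‖ₑ * ‖⟪onb E i, W (u k)⟫_ℂ‖ₑ := by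
    calc ENNReal.ofReal (RCLike.re ⟪operatorModulus A (onb E i), onb E i⟫_ℂ)
        ≤ ‖⟪operatorModulus A (onb E i), onb E i⟫_ℂ‖ₑ := by
          rw [← ofReal_norm]
          exact ENNReal.ofReal_le_ofReal (RCLike.re_le_norm _)
      _ = ‖∑' k, ⟪v k, onb E i⟫_ℂ * ⟪W.adjoint (onb E i), u k⟫_ℂ‖ₑ := by
          rw [(h _ _).tsum_eq, ContinuousLinearMap.adjoint_inner_left, hW, enorm_inner_symm]
      _ ≤ ∑' k, ‖⟪v k, onb E i⟫_ℂ * ⟪W.adjoint (onb E i), u k⟫_ℂ‖ₑ := enorm_tsum_le_tsum_enorm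
      _ = ∑' k, ‖⟪onb E i, v k⟫_ℂ‖ₑ * ‖⟪onb E i, W (u k)⟫_ℂ‖ₑ := by
          simp only [enorm_mul, ContinuousLinearMap.adjoint_inner_left, enorm_inner_symm (v _)]
  calc traceNorm A
      ≤ ∑' i, ∑' k, ‖⟪onb E i, v k⟫_ℂ‖ₑ * ‖⟪onb E i, W (u k)⟫_ℂ‖ₑ :=
        ENNReal.tsum_le_tsum diagonal_le
    _ = ∑' k, ∑' i, ‖⟪onb E i, v k⟫_ℂ‖ₑ * ‖⟪onb E i, W (u k)⟫_ℂ‖ₑ := ENNReal.tsum_comm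
    _ ≤ ∑' k, ‖v k‖ₑ * ‖W (u k)‖ₑ := ENNReal.tsum_le_tsum fun k =>
        tsum_mul_le_mul_of_tsum_sq_le (tsum_enorm_sq_inner_hilbertBasis _ _).le
          (tsum_enorm_sq_inner_hilbertBasis _ _).le
    _ ≤ ∑' k, ‖u k‖ₑ * ‖v k‖ₑ := ENNReal.tsum_le_tsum fun k => by
        rw [mul_comm]
        gcongr
        exact enorm_le_iff_norm_le.2 ((W.le_of_opNorm_le norm_W _).trans_eq (one_mul _))

/-- The expansion comes from writing `A = W |A|^{1/2} |A|^{1/2}` with a contraction `W`. -/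
lemma exists_isNuclearExpansion (A : E →L[ℂ] F) :
    ∃ (u : onbIndex E → F) (v : onbIndex E → E), IsNuclearExpansion A u v ∧
      ∑' k, ‖u k‖ₑ ^ 2 ≤ traceNorm A ∧ ∑' k, ‖v k‖ₑ ^ 2 ≤ traceNorm A := by
  obtain ⟨W, norm_W, hW⟩ :=
    exists_comp_eq_of_norm_apply_le fun x => (norm_operatorModulus_apply A x).ge
  have modulus_nonneg : 0 ≤ operatorModulus A := CFC.sqrt_nonneg _
  set D := CFC.sqrt (operatorModulus A)
  have adjoint_D : D.adjoint = D := (CFC.sqrt_nonneg _).isSelfAdjoint.adjoint_eq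
  have W_D_D (x : E) : W (D (D x)) = A x := by
    rw [← hW, ← CFC.sqrt_mul_sqrt_self _ modulus_nonneg, mul_apply_eq_comp]
  have sum_sq_le : ∑' k, ‖D (onb E k)‖ₑ ^ 2 ≤ traceNorm A := by
    refine ENNReal.tsum_le_tsum fun k => ?_
    rw [← ofReal_norm, ← ENNReal.ofReal_pow (norm_nonneg _), ← inner_self_eq_norm_sq (𝕜 := ℂ),
      inner_sqrt_apply_sqrt_apply modulus_nonneg, inner_re_symm]
  refine ⟨fun k => W (D (onb E k)), fun k => D (onb E k), fun x y => ?_, ?_, sum_sq_le⟩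
  · have expansion := (onb E).hasSum_inner_mul_inner (D (W.adjoint y)) (D x)
    rw [← adjoint_D, ContinuousLinearMap.adjoint_inner_left, adjoint_D,
      ContinuousLinearMap.adjoint_inner_left, W_D_D] at expansion
    refine expansion.congr_fun fun k => ?_
    rw [mul_comm, ← ContinuousLinearMap.adjoint_inner_left D, adjoint_D,
      ← ContinuousLinearMap.adjoint_inner_left W, ← ContinuousLinearMap.adjoint_inner_left D,
      adjoint_D]
  · refine (ENNReal.tsum_le_tsum fun k => ?_).trans sum_sq_le
    gcongr
    exact enorm_le_iff_norm_le.2 ((W.le_of_opNorm_le norm_W _).trans_eq (one_mul _))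

end TraceNorm

section NuclearSums

variable {𝕜 : Type*} [RCLike 𝕜]
  {E : Type*} [NormedAddCommGroup E] [InnerProductSpace 𝕜 E] [CompleteSpace E]
  {E' : Type*} [NormedAddCommGroup E'] [InnerProductSpace 𝕜 E'] [CompleteSpace E']
  {F : Type*} [NormedAddCommGroup F] [InnerProductSpace 𝕜 F] [CompleteSpace F]
  {F' : Type*} [NormedAddCommGroup F'] [InnerProductSpace 𝕜 F'] [CompleteSpace F']

lemma IsNuclearExpansion.of_hasSum {ι κ : Type*} {A : E →L[𝕜] F} {B : E' →L[𝕜] F'} {u : ι → F}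
    {v : ι → E} (hA : IsNuclearExpansion A u v) {X : κ → F →L[𝕜] F'} {Y : κ → E' →L[𝕜] E}
    (hB : ∀ x y, HasSum (fun n => ⟪y, X n (A (Y n x))⟫_𝕜) ⟪y, B x⟫_𝕜)
    (summable : ∑' q : κ × ι, ‖X q.1 (u q.2)‖ₑ * ‖(Y q.1).adjoint (v q.2)‖ₑ ≠ ∞) :
    IsNuclearExpansion B (fun q : κ × ι => X q.1 (u q.2))
      (fun q => (Y q.1).adjoint (v q.2)) := by
  intro x y
  have summable_terms : Summable fun q : κ × ι =>
      ⟪(Y q.1).adjoint (v q.2), x⟫_𝕜 * ⟪y, X q.1 (u q.2)⟫_𝕜 := by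
    refine ((ENNReal.summable_toReal summable).mul_left (‖x‖ * ‖y‖)).of_norm_bounded fun q => ?_
    rw [norm_mul, ENNReal.toReal_mul, toReal_enorm, toReal_enorm]
    calc ‖⟪(Y q.1).adjoint (v q.2), x⟫_𝕜‖ * ‖⟪y, X q.1 (u q.2)⟫_𝕜‖
        ≤ (‖(Y q.1).adjoint (v q.2)‖ * ‖x‖) * (‖y‖ * ‖X q.1 (u q.2)‖) := by
          gcongr <;> exact norm_inner_le_norm _ _
      _ = ‖x‖ * ‖y‖ * (‖X q.1 (u q.2)‖ * ‖(Y q.1).adjoint (v q.2)‖) := by ring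
  have fiber (n : κ) : HasSum
      (fun k => ⟪(Y n).adjoint (v k), x⟫_𝕜 * ⟪y, X n (u k)⟫_𝕜) ⟪y, X n (A (Y n x))⟫_𝕜 := by
    simpa only [ContinuousLinearMap.adjoint_inner_left] using hA (Y n x) ((X n).adjoint y)
  rw [(hB x y).unique (summable_terms.hasSum.prod_fiberwise fiber)]
  exact summable_terms.hasSum

end NuclearSums

lemma tsum_prod_enorm_sq_le {ι κ G G' : Type*} [NormedAddCommGroup G] [NormedAddCommGroup G']
    {Z : κ → G → G'} {C : ℝ≥0∞} (hZ : ∀ g, ∑' n, ‖Z n g‖ₑ ^ 2 ≤ C * ‖g‖ₑ ^ 2) (w : ι → G) :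
    ∑' q : κ × ι, ‖Z q.1 (w q.2)‖ₑ ^ 2 ≤ C * ∑' k, ‖w k‖ₑ ^ 2 := by
  rw [ENNReal.tsum_prod', ENNReal.tsum_comm, ← ENNReal.tsum_mul_left]
  exact ENNReal.tsum_le_tsum fun k => hZ (w k)

section TraceNormSums

variable {E : Type*} [NormedAddCommGroup E] [InnerProductSpace ℂ E] [CompleteSpace E]
  {E' : Type*} [NormedAddCommGroup E'] [InnerProductSpace ℂ E'] [CompleteSpace E']
  {F : Type*} [NormedAddCommGroup F] [InnerProductSpace ℂ F] [CompleteSpace F]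
  {F' : Type*} [NormedAddCommGroup F'] [InnerProductSpace ℂ F'] [CompleteSpace F']

lemma traceNorm_le_mul_of_hasSum {κ : Type*} {A : E →L[ℂ] F} {B : E' →L[ℂ] F'}
    (hA : IsTraceClass A) {X : κ → F →L[ℂ] F'} {Y : κ → E' →L[ℂ] E} {C : ℝ≥0}
    (hX : ∀ f, ∑' n, ‖X n f‖ₑ ^ 2 ≤ C * ‖f‖ₑ ^ 2)
    (hY : ∀ g, ∑' n, ‖(Y n).adjoint g‖ₑ ^ 2 ≤ C * ‖g‖ₑ ^ 2)
    (hB : ∀ x y, HasSum (fun n => ⟪y, X n (A (Y n x))⟫_ℂ) ⟪y, B x⟫_ℂ) :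
    traceNorm B ≤ C * traceNorm A := by
  obtain ⟨u, v, expansion, sum_u_le, sum_v_le⟩ := exists_isNuclearExpansion A
  have sum_le : ∑' q : κ × onbIndex E, ‖X q.1 (u q.2)‖ₑ * ‖(Y q.1).adjoint (v q.2)‖ₑ
      ≤ C * traceNorm A :=
    tsum_mul_le_of_tsum_sq_le
      ((tsum_prod_enorm_sq_le (Z := fun n => X n) hX u).trans (by gcongr))
      ((tsum_prod_enorm_sq_le (Z := fun n => (Y n).adjoint) hY v).trans (by gcongr))
  exact (expansion.of_hasSum hB (ne_top_of_le_ne_top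
    (ENNReal.mul_ne_top ENNReal.coe_ne_top hA.ne) sum_le)).traceNorm_le.trans sum_le

end TraceNormSums

section Multiplication

variable {α : Type*} [MeasurableSpace α] {m : Measure α}

lemma enorm_lp_sq (f : Lp ℂ 2 m) : ‖f‖ₑ ^ 2 = ∫⁻ a, ‖f a‖ₑ ^ 2 ∂m := by
  rw [Lp.enorm_def, eLpNorm_two_sq]

/-- Multiplication by an essentially bounded function, as an operator on `L²`. -/
noncomputable def mulOperator {φ : α → ℂ} (hφ : MemLp φ ∞ m) : Lp ℂ 2 m →L[ℂ] Lp ℂ 2 m :=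
  (ContinuousLinearMap.mul ℂ ℂ).holderL m ∞ 2 2 (hφ.toLp φ)

lemma coeFn_mulOperator {φ : α → ℂ} (hφ : MemLp φ ∞ m) (f : Lp ℂ 2 m) :
    mulOperator hφ f =ᵐ[m] fun a => φ a * f a := by
  filter_upwards [(ContinuousLinearMap.mul ℂ ℂ).coeFn_holder (r := 2) (hφ.toLp φ) f,
    hφ.coeFn_toLp] with a holder_apply toLp_apply
  exact holder_apply.trans (congrArg (· * f a) toLp_apply)

lemma adjoint_mulOperator {φ : α → ℂ} (hφ : MemLp φ ∞ m) :
    (mulOperator hφ).adjoint = mulOperator hφ.star := by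
  refine ((ContinuousLinearMap.eq_adjoint_iff _ _).2 fun f g => ?_).symm
  rw [L2.inner_def, L2.inner_def]
  refine integral_congr_ae ?_
  filter_upwards [coeFn_mulOperator hφ g, coeFn_mulOperator hφ.star f] with a apply_g apply_f
  simp only [apply_f, apply_g, Pi.star_apply, RCLike.inner_apply, RCLike.star_def, map_mul,
    RCLike.conj_conj]
  ring

lemma tsum_enorm_sq_mulOperator_le {φ : ℕ → α → ℂ} (hφ : ∀ n, MemLp (φ n) ∞ m) {C : ℝ≥0}
    (h : ∀ᵐ a ∂m, ∑' n, ‖φ n a‖ₑ ^ 2 ≤ C) (f : Lp ℂ 2 m) :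
    ∑' n, ‖mulOperator (hφ n) f‖ₑ ^ 2 ≤ C * ‖f‖ₑ ^ 2 := by
  simp only [enorm_lp_sq]
  rw [← lintegral_tsum fun n => (Lp.aestronglyMeasurable _).enorm.pow_const 2,
    ← lintegral_const_mul' _ _ ENNReal.coe_ne_top]
  refine lintegral_mono_ae ?_
  filter_upwards [h, ae_all_iff.2 fun n => coeFn_mulOperator (hφ n) f] with a sum_le apply_f
  simp only [apply_f, enorm_mul, mul_pow, ENNReal.tsum_mul_right]
  gcongr

end Multiplication

section KernelPairing

variable {S : Type u} {T : Type v} [MeasurableSpace S] [MeasurableSpace T]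
  {μ : Measure S} {ν : Measure T}

lemma memLp_two_mul_prod {a : S → ℂ} {c : T → ℂ} (ha : MemLp a 2 μ) (hc : MemLp c 2 ν) :
    MemLp (fun p : S × T => a p.1 * c p.2) 2 (μ.prod ν) := by
  refine (memLp_two_iff_integrable_sq_norm (ha.1.comp_fst.mul hc.1.comp_snd)).2 ?_
  simpa only [Pi.mul_apply, norm_mul, mul_pow] using
    ((memLp_two_iff_integrable_sq_norm ha.1).1 ha).mul_prod
      ((memLp_two_iff_integrable_sq_norm hc.1).1 hc)

lemma integrable_kernel_pairing {h : S × T → ℂ} (hh : MemLp h 2 (μ.prod ν)) {y : S → ℂ}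
    {x : T → ℂ} (hy : MemLp y 2 μ) (hx : MemLp x 2 ν) :
    Integrable (fun p => h p * (y p.1 * x p.2)) (μ.prod ν) :=
  hh.integrable_mul (memLp_two_mul_prod hy hx)

variable [SigmaFinite μ] [SigmaFinite ν]

lemma inner_integralOperator {h : S × T → ℂ} (hh : MemLp h 2 (μ.prod ν)) (y : Lp ℂ 2 μ)
    (x : Lp ℂ 2 ν) : ⟪y, integralOperator h hh x⟫_ℂ
      = ∫ p, h p * (starRingEnd ℂ (y p.1) * x p.2) ∂(μ.prod ν) := by
  have integrable : Integrable (fun p => h p * (starRingEnd ℂ (y p.1) * x p.2)) (μ.prod ν) :=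
    integrable_kernel_pairing hh (Lp.memLp y).star (Lp.memLp x)
  rw [integral_prod _ integrable, L2.inner_def]
  refine integral_congr_ae ?_
  filter_upwards [(kernelIntegral_memLp hh (Lp.memLp x)).coeFn_toLp] with s apply_s
  refine (congrArg _ apply_s).trans ?_
  rw [RCLike.inner_apply, kernelIntegral, mul_comm, ← integral_const_mul]
  congr 1 with t
  ring

lemma inner_integralOperator_of_ae_eq {h : S × T → ℂ} (hh : MemLp h 2 (μ.prod ν))
    {y : Lp ℂ 2 μ} {x : Lp ℂ 2 ν} {g : S → ℂ} {f : T → ℂ} (hy : y =ᵐ[μ] g) (hx : x =ᵐ[ν] f) :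
    ⟪y, integralOperator h hh x⟫_ℂ
      = ∫ p, h p * (starRingEnd ℂ (g p.1) * f p.2) ∂(μ.prod ν) := by
  rw [inner_integralOperator]
  refine integral_congr_ae ?_
  filter_upwards [Measure.quasiMeasurePreserving_fst.ae hy,
    Measure.quasiMeasurePreserving_snd.ae hx] with p hy_p hx_p
  rw [hy_p, hx_p]

end KernelPairing

section BoundedExpansion

variable {S : Type u} {T : Type v} [MeasurableSpace S] [MeasurableSpace T]
  {μ : Measure S} {ν : Measure T} {Φ : S × T → ℂ} {C : ℝ≥0} {φ : ℕ → S → ℂ} {ψ : ℕ → T → ℂ}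

/-- `Φ = ∑ φ_n ⊗ ψ_n` almost everywhere, with `∑ |φ_n|² ≤ C` and `∑ |ψ_n|² ≤ C`: the expansions
of condition (iii) of the theorem. -/
structure IsBoundedExpansion (μ : Measure S) (ν : Measure T) (Φ : S × T → ℂ) (C : ℝ≥0)
    (φ : ℕ → S → ℂ) (ψ : ℕ → T → ℂ) : Prop where
  left_memLp : ∀ n, MemLp (φ n) ∞ μ
  right_memLp : ∀ n, MemLp (ψ n) ∞ ν
  hasSum : ∀ᵐ p ∂(μ.prod ν), HasSum (fun n => φ n p.1 * ψ n p.2) (Φ p)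
  left_le : ∀ᵐ s ∂μ, ∑' n, ‖φ n s‖ₑ ^ 2 ≤ C
  right_le : ∀ᵐ t ∂ν, ∑' n, ‖ψ n t‖ₑ ^ 2 ≤ C

namespace IsBoundedExpansion

lemma tsum_enorm_le (H : IsBoundedExpansion μ ν Φ C φ ψ) :
    ∀ᵐ p ∂(μ.prod ν), ∑' n, ‖φ n p.1 * ψ n p.2‖ₑ ≤ C := by
  filter_upwards [Measure.quasiMeasurePreserving_fst.ae H.left_le,
    Measure.quasiMeasurePreserving_snd.ae H.right_le] with p left_le right_le
  simpa only [enorm_mul] using tsum_mul_le_of_tsum_sq_le left_le right_le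

lemma aestronglyMeasurable_term (H : IsBoundedExpansion μ ν Φ C φ ψ) (n : ℕ) :
    AEStronglyMeasurable (fun p : S × T => φ n p.1 * ψ n p.2) (μ.prod ν) :=
  (H.left_memLp n).1.comp_fst.mul (H.right_memLp n).1.comp_snd

lemma aestronglyMeasurable (H : IsBoundedExpansion μ ν Φ C φ ψ) :
    AEStronglyMeasurable Φ (μ.prod ν) := by
  refine aestronglyMeasurable_of_tendsto_ae atTop
    (f := fun N p => ∑ n ∈ Finset.range N, φ n p.1 * ψ n p.2) (fun N => ?_) ?_
  · exact Finset.aestronglyMeasurable_fun_sum _ fun n _ => H.aestronglyMeasurable_term n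
  · filter_upwards [H.hasSum] with p hp using hp.tendsto_sum_nat

lemma memLp_top (H : IsBoundedExpansion μ ν Φ C φ ψ) : MemLp Φ ∞ (μ.prod ν) := by
  refine memLp_top_of_bound H.aestronglyMeasurable C ?_
  filter_upwards [H.tsum_enorm_le, H.hasSum] with p sum_le hasSum
  rw [← toReal_enorm, ← ENNReal.coe_toReal, ← hasSum.tsum_eq]
  exact ENNReal.toReal_mono ENNReal.coe_ne_top (enorm_tsum_le_tsum_enorm.trans sum_le)

lemma memLp_mul (H : IsBoundedExpansion μ ν Φ C φ ψ) {h : S × T → ℂ}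
    (hh : MemLp h 2 (μ.prod ν)) : MemLp (fun p => Φ p * h p) 2 (μ.prod ν) :=
  hh.mul (p := ∞) (q := 2) H.memLp_top

lemma hasSum_integral (H : IsBoundedExpansion μ ν Φ C φ ψ) {g : S × T → ℂ}
    (hg : Integrable g (μ.prod ν)) :
    HasSum (fun n => ∫ p, φ n p.1 * ψ n p.2 * g p ∂(μ.prod ν)) (∫ p, Φ p * g p ∂(μ.prod ν)) := by
  have aestronglyMeasurable_mul (n : ℕ) :
      AEStronglyMeasurable (fun p => φ n p.1 * ψ n p.2 * g p) (μ.prod ν) :=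
    (H.aestronglyMeasurable_term n).mul hg.1
  have tsum_lintegral_ne_top :
      ∑' n, ∫⁻ p, ‖φ n p.1 * ψ n p.2 * g p‖ₑ ∂(μ.prod ν) ≠ ∞ := by
    rw [← lintegral_tsum fun n => (aestronglyMeasurable_mul n).enorm]
    refine ((lintegral_mono_ae (g := fun p => C * ‖g p‖ₑ) ?_).trans_lt ?_).ne
    · filter_upwards [H.tsum_enorm_le] with p sum_le
      simp only [enorm_mul _ (g p), ENNReal.tsum_mul_right]
      gcongr
    · rw [lintegral_const_mul' _ _ ENNReal.coe_ne_top]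
      exact ENNReal.mul_lt_top ENNReal.coe_lt_top hg.2
  have integral_eq : ∫ p, Φ p * g p ∂(μ.prod ν)
      = ∫ p, ∑' n, φ n p.1 * ψ n p.2 * g p ∂(μ.prod ν) := by
    refine integral_congr_ae ?_
    filter_upwards [H.hasSum] with p hasSum using (hasSum.mul_right (g p)).tsum_eq.symm
  rw [integral_eq]
  refine hasSum_integral_of_summable_integral_norm (fun n => ⟨?_, ?_⟩)
    ((ENNReal.summable_toReal tsum_lintegral_ne_top).congr fun n => ?_)
  · exact aestronglyMeasurable_mul n
  · exact (ENNReal.ne_top_of_tsum_ne_top tsum_lintegral_ne_top n).lt_top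
  · exact (integral_norm_eq_lintegral_enorm (aestronglyMeasurable_mul n)).symm

variable [SigmaFinite μ] [SigmaFinite ν]

lemma traceNorm_le (H : IsBoundedExpansion μ ν Φ C φ ψ) {h : S × T → ℂ}
    (hh : MemLp h 2 (μ.prod ν)) (trace_class : IsTraceClass (integralOperator h hh)) :
    traceNorm (integralOperator (fun p => Φ p * h p) (H.memLp_mul hh))
      ≤ C * traceNorm (integralOperator h hh) := by
  refine traceNorm_le_mul_of_hasSum trace_class (X := fun n => mulOperator (H.left_memLp n))
    (Y := fun n => mulOperator (H.right_memLp n))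
    (tsum_enorm_sq_mulOperator_le H.left_memLp H.left_le) (fun g => ?_) fun x y => ?_
  · simp only [adjoint_mulOperator]
    exact tsum_enorm_sq_mulOperator_le _
      (by simpa only [Pi.star_apply, RCLike.star_def, RCLike.enorm_conj] using H.right_le) g
  · convert H.hasSum_integral
      (integrable_kernel_pairing hh (Lp.memLp y).star (Lp.memLp x)) using 1
    · ext n
      rw [← ContinuousLinearMap.adjoint_inner_left, adjoint_mulOperator,
        inner_integralOperator_of_ae_eq hh (coeFn_mulOperator _ y) (coeFn_mulOperator _ x)]
      congr 1 with p
      simp only [Pi.star_apply, RCLike.star_def, map_mul, RCLike.conj_conj]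
      ring
    · rw [inner_integralOperator]
      simp only [Pi.star_apply, RCLike.star_def, mul_assoc]

lemma isSchurBound (H : IsBoundedExpansion μ ν Φ C φ ψ) : IsSchurBound μ ν Φ C :=
  fun _ hh trace_class => ⟨H.memLp_mul hh, H.traceNorm_le hh trace_class⟩

lemma isSchurMultiplier (H : IsBoundedExpansion μ ν Φ C φ ψ) : IsSchurMultiplier μ ν Φ :=
  ⟨H.aestronglyMeasurable, fun _ hh trace_class => ⟨H.memLp_mul hh,
    (H.traceNorm_le hh trace_class).trans_lt (ENNReal.mul_lt_top ENNReal.coe_lt_top trace_class)⟩⟩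

end IsBoundedExpansion

end BoundedExpansion

section FiniteFactorization

open scoped MatrixOrder ComplexOrder in
lemma exists_euclidean_gram {n : Type*} [Fintype n] {H : Type*} [NormedAddCommGroup H]
    [InnerProductSpace ℂ H] (z : n → H) :
    ∃ w : n → EuclideanSpace ℂ n, ∀ p q, ⟪w p, w q⟫_ℂ = ⟪z p, z q⟫_ℂ := by
  classical
  obtain ⟨B, gram_eq⟩ := CStarAlgebra.nonneg_iff_eq_star_mul_self.mp
    (Matrix.posSemidef_gram ℂ z).nonneg
  refine ⟨fun p => WithLp.toLp 2 fun r => B r p, fun p q => ?_⟩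
  rw [← Matrix.gram_apply (𝕜 := ℂ) z, gram_eq, PiLp.inner_apply, Matrix.mul_apply]
  refine Finset.sum_congr rfl fun r _ => ?_
  rw [RCLike.inner_apply, Matrix.star_apply, mul_comm, RCLike.star_def]

variable {ι κ : Type*} [Fintype ι] [Fintype κ]

/-- `Ψ i j = ⟪w j, w i⟫` for some vectors with `‖w p‖² ≤ d p`. Since only the Gram matrix of the
vectors matters, they are taken in a space of dimension `|ι| + |κ|`. -/
def HasGramFactorization (d : ι ⊕ κ → ℝ) (Ψ : ι → κ → ℂ) : Prop :=
  ∃ w : ι ⊕ κ → EuclideanSpace ℂ (ι ⊕ κ), (∀ p, ‖w p‖ ^ 2 ≤ d p) ∧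
    ∀ i j, ⟪w (.inr j), w (.inl i)⟫_ℂ = Ψ i j

namespace HasGramFactorization

variable {d d' : ι ⊕ κ → ℝ} {Ψ Ψ' : ι → κ → ℂ}

lemma of_inner {H : Type*} [NormedAddCommGroup H] [InnerProductSpace ℂ H] (w : ι ⊕ κ → H)
    (norm_le : ∀ p, ‖w p‖ ^ 2 ≤ d p) (inner_eq : ∀ i j, ⟪w (.inr j), w (.inl i)⟫_ℂ = Ψ i j) :
    HasGramFactorization d Ψ := by
  obtain ⟨w', inner_w'⟩ := exists_euclidean_gram w
  refine ⟨w', fun p => ?_, fun i j => by rw [inner_w', inner_eq]⟩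
  rw [← inner_self_eq_norm_sq (𝕜 := ℂ), inner_w', inner_self_eq_norm_sq]
  exact norm_le p

lemma zero : HasGramFactorization (0 : ι ⊕ κ → ℝ) (0 : ι → κ → ℂ) :=
  ⟨0, by simp, by simp⟩

lemma add (h : HasGramFactorization d Ψ) (h' : HasGramFactorization d' Ψ') :
    HasGramFactorization (d + d') (Ψ + Ψ') := by
  obtain ⟨w, norm_le, inner_eq⟩ := h
  obtain ⟨w', norm_le', inner_eq'⟩ := h'
  refine of_inner (fun p => WithLp.toLp 2 (w p, w' p)) (fun p => ?_) fun i j => ?_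
  · rw [WithLp.prod_norm_sq_eq_of_L2]
    exact add_le_add (norm_le p) (norm_le' p)
  · rw [WithLp.prod_inner_apply]
    exact congrArg₂ (· + ·) (inner_eq i j) (inner_eq' i j)

lemma smul (h : HasGramFactorization d Ψ) {t : ℝ} (ht : 0 ≤ t) :
    HasGramFactorization (t • d) (t • Ψ) := by
  obtain ⟨w, norm_le, inner_eq⟩ := h
  refine ⟨fun p => √t • w p, fun p => ?_, fun i j => ?_⟩
  · rw [norm_smul, mul_pow, Real.norm_eq_abs, sq_abs, Real.sq_sqrt ht]
    exact mul_le_mul_of_nonneg_left (norm_le p) ht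
  · rw [inner_smul_left_eq_smul, inner_smul_right_eq_smul, inner_eq, smul_smul,
      Real.mul_self_sqrt ht]
    rfl

end HasGramFactorization

lemma isClosed_setOf_hasGramFactorization :
    IsClosed {z : (ι ⊕ κ → ℝ) × (ι → κ → ℂ) | HasGramFactorization z.1 z.2} := by
  refine IsSeqClosed.isClosed fun z z₀ factorization z_tendsto => ?_
  choose w norm_le inner_eq using factorization
  have d_tendsto := ((Prod.tendsto_iff _ _).1 z_tendsto).1
  have Ψ_tendsto := ((Prod.tendsto_iff _ _).1 z_tendsto).2
  obtain ⟨K, norm_d_le⟩ := (Metric.isBounded_range_of_tendsto _ d_tendsto).exists_norm_le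
  have w_mem (n : ℕ) : w n ∈ Metric.closedBall (0 : ι ⊕ κ → EuclideanSpace ℂ (ι ⊕ κ)) √K := by
    rw [mem_closedBall_zero_iff, pi_norm_le_iff_of_nonneg (Real.sqrt_nonneg _)]
    exact fun p => Real.le_sqrt_of_sq_le ((norm_le n p).trans ((le_abs_self _).trans
      ((norm_le_pi_norm (z n).1 p).trans (norm_d_le _ ⟨n, rfl⟩))))
  obtain ⟨w₀, -, σ, σ_mono, w_tendsto⟩ := (isCompact_closedBall _ _).tendsto_subseq w_mem
  rw [tendsto_pi_nhds] at w_tendsto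
  refine ⟨w₀, fun p => ?_, fun i j => ?_⟩
  · exact le_of_tendsto_of_tendsto' ((w_tendsto p).norm.pow 2)
      ((tendsto_pi_nhds.1 d_tendsto p).comp σ_mono.tendsto_atTop) fun n => norm_le (σ n) p
  · refine tendsto_nhds_unique ((w_tendsto (.inr j)).inner (w_tendsto (.inl i))) ?_
    simp only [comp_apply, inner_eq]
    exact (tendsto_pi_nhds.1 (tendsto_pi_nhds.1 Ψ_tendsto i) j).comp σ_mono.tendsto_atTop

variable (ι κ) in
/-- The pairs `(d, Ψ)` such that `Ψ` has a Gram factorization with squared norms at most `d`. -/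
def gramCone : ProperCone ℝ ((ι ⊕ κ → ℝ) × (ι → κ → ℂ)) where
  carrier := {z | HasGramFactorization z.1 z.2}
  add_mem' := HasGramFactorization.add
  zero_mem' := HasGramFactorization.zero
  smul_mem' t _ h := h.smul t.2
  isClosed' := isClosed_setOf_hasGramFactorization

lemma exists_eq_re_sum_mul (f : (ι → κ → ℂ) →ₗ[ℝ] ℝ) :
    ∃ k : ι → κ → ℂ, ∀ Ψ, f Ψ = (∑ i, ∑ j, k i j * Ψ i j).re := by
  classical
  have exists_eq_re_mul (g : ℂ →ₗ[ℝ] ℝ) : ∃ k : ℂ, ∀ z, g z = (k * z).re := by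
    refine ⟨⟨g 1, -g Complex.I⟩, fun z => ?_⟩
    have z_eq : z = z.re • (1 : ℂ) + z.im • Complex.I := by simp
    conv_lhs => rw [z_eq]
    rw [map_add, map_smul, map_smul, Complex.mul_re, smul_eq_mul, smul_eq_mul]
    ring
  choose k hk using fun i j => exists_eq_re_mul
    (f ∘ₗ LinearMap.single ℝ (fun _ => κ → ℂ) i ∘ₗ LinearMap.single ℝ (fun _ => ℂ) j)
  refine ⟨k, fun Ψ => ?_⟩
  simp only [Complex.re_sum, ← hk]
  conv_lhs => rw [← Finset.univ_sum_single Ψ]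
  rw [map_sum]
  refine Finset.sum_congr rfl fun i _ => ?_
  conv_lhs => rw [← Finset.univ_sum_single (Ψ i)]
  exact map_sum (f ∘ₗ LinearMap.single ℝ (fun _ => κ → ℂ) i) _ _

lemma exists_dual_of_not_hasGramFactorization {d₀ : ι ⊕ κ → ℝ} {Φ : ι → κ → ℂ}
    (h : ¬ HasGramFactorization d₀ Φ) :
    ∃ (d : ι ⊕ κ → ℝ) (k : ι → κ → ℂ), (∀ p, 0 ≤ d p) ∧
      (∀ (ξ : ι → ℂ) (η : κ → ℂ), (∑ i, ∑ j, k i j * (ξ i * η j)).re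
        ≤ ∑ i, d (.inl i) * ‖ξ i‖ ^ 2 + ∑ j, d (.inr j) * ‖η j‖ ^ 2) ∧
      ∑ p, d p * d₀ p < (∑ i, ∑ j, k i j * Φ i j).re := by
  classical
  obtain ⟨f, f_nonneg, f_neg⟩ := (gramCone ι κ).hyperplane_separation_point
    (x₀ := (d₀, Φ)) h
  obtain ⟨k, hk⟩ := exists_eq_re_sum_mul (-(f.toLinearMap ∘ₗ LinearMap.inr ℝ _ _))
  let d : ι ⊕ κ → ℝ := fun p => f (fun q => if p = q then 1 else 0, 0)
  have f_left (u : ι ⊕ κ → ℝ) : f (u, 0) = ∑ p, d p * u p := by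
    rw [← ContinuousLinearMap.coe_coe, ← LinearMap.inl_apply (R := ℝ), ← LinearMap.comp_apply,
      LinearMap.pi_apply_eq_sum_univ]
    exact Finset.sum_congr rfl fun p _ => mul_comm _ _
  have f_eq (u : ι ⊕ κ → ℝ) (Ψ : ι → κ → ℂ) :
      f (u, Ψ) = ∑ p, d p * u p - (∑ i, ∑ j, k i j * Ψ i j).re := by
    rw [← hk, ← f_left, LinearMap.neg_apply, sub_neg_eq_add, LinearMap.comp_apply,
      LinearMap.inr_apply, ContinuousLinearMap.coe_coe, ← map_add, Prod.mk_add_mk, add_zero,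
      zero_add]
  refine ⟨d, k, fun p => ?_, fun ξ η => ?_, ?_⟩
  · refine f_nonneg _ (.of_inner (fun _ => (0 : ℂ)) (fun q => ?_) (by simp))
    rw [norm_zero, zero_pow two_ne_zero]
    dsimp only
    split_ifs <;> norm_num
  · have rank_one_mem : HasGramFactorization
        (Sum.elim (fun i => ‖ξ i‖ ^ 2) (fun j => ‖η j‖ ^ 2)) (fun i j => ξ i * η j) :=
      .of_inner (Sum.elim ξ fun j => starRingEnd ℂ (η j)) (by rintro (i | j) <;> simp) (by simp)
    have := f_nonneg (_, _) rank_one_mem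
    rw [f_eq, Fintype.sum_sum_type] at this
    exact sub_nonneg.1 this
  · rw [f_eq] at f_neg
    exact sub_neg.1 f_neg

/-- The bilinear form `(ξ, η) ↦ ∑ β i j ξ i η j` is contractive for the Euclidean norms. -/
def IsContractiveForm (β : ι → κ → ℂ) : Prop :=
  ∀ (ξ : ι → ℂ) (η : κ → ℂ), ‖∑ i, ∑ j, β i j * (ξ i * η j)‖
    ≤ √(∑ i, ‖ξ i‖ ^ 2) * √(∑ j, ‖η j‖ ^ 2)

lemma isContractiveForm_half {k : ι → κ → ℂ}
    (h : ∀ (ξ : ι → ℂ) (η : κ → ℂ), (∑ i, ∑ j, k i j * (ξ i * η j)).re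
      ≤ ∑ i, ‖ξ i‖ ^ 2 + ∑ j, ‖η j‖ ^ 2) : IsContractiveForm fun i j => k i j / 2 := by
  intro ξ η
  set a := ∑ i, ‖ξ i‖ ^ 2
  set b := ∑ j, ‖η j‖ ^ 2
  set z := ∑ i, ∑ j, k i j * (ξ i * η j) with hz
  have a_nonneg : 0 ≤ a := Finset.sum_nonneg fun _ _ => sq_nonneg _
  obtain ⟨θ, norm_θ, norm_z_eq⟩ := RCLike.exists_norm_eq_mul_self z
  have quadratic_bound (t : ℝ) : t * ‖z‖ ≤ t ^ 2 * a + b := by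
    have rotated : ∑ i, ∑ j, k i j * ((t : ℂ) * θ * ξ i * η j) = ((t * ‖z‖ : ℝ) : ℂ) := by
      rw [Complex.ofReal_mul, show ((‖z‖ : ℝ) : ℂ) = θ * z from norm_z_eq, hz]
      simp only [Finset.mul_sum]
      exact Finset.sum_congr rfl fun i _ => Finset.sum_congr rfl fun j _ => by ring
    have bound := h (fun i => (t : ℂ) * θ * ξ i) η
    rw [rotated, Complex.ofReal_re] at bound
    simpa only [norm_mul, mul_pow, norm_θ, Complex.norm_real, Real.norm_eq_abs, sq_abs, one_pow,
      mul_one, ← Finset.mul_sum] using bound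
  have discrim_nonpos := discrim_le_zero (a := a) (b := -‖z‖) (c := b) fun t => by
    linarith [quadratic_bound t]
  rw [discrim, neg_sq] at discrim_nonpos
  have norm_sq_le : (‖z‖ / 2) ^ 2 ≤ a * b := by linarith
  calc ‖∑ i, ∑ j, k i j / 2 * (ξ i * η j)‖ = ‖z‖ / 2 := by
        simp only [div_mul_eq_mul_div, ← Finset.sum_div]
        rw [norm_div, Complex.norm_ofNat]
    _ ≤ √a * √b := by
        rw [← Real.sqrt_mul a_nonneg]
        exact Real.le_sqrt_of_sq_le norm_sq_le

lemma isContractiveForm_of_weighted {k : ι → κ → ℂ} {d : ι → ℝ} {d' : κ → ℝ}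
    (hd : ∀ i, 0 < d i) (hd' : ∀ j, 0 < d' j)
    (h : ∀ (ξ : ι → ℂ) (η : κ → ℂ), (∑ i, ∑ j, k i j * (ξ i * η j)).re
      ≤ ∑ i, d i * ‖ξ i‖ ^ 2 + ∑ j, d' j * ‖η j‖ ^ 2) :
    IsContractiveForm fun i j => k i j / (√(d i) * √(d' j) : ℝ) / 2 := by
  refine isContractiveForm_half fun ξ η => ?_
  have weight_mul {x : ℝ} (hx : 0 < x) (z : ℂ) : x * ‖z / (√x : ℝ)‖ ^ 2 = ‖z‖ ^ 2 := by
    rw [norm_div, div_pow, Complex.norm_real, Real.norm_eq_abs, sq_abs, Real.sq_sqrt hx.le,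
      mul_div_cancel₀ _ hx.ne']
  have := h (fun i => ξ i / (√(d i) : ℝ)) (fun j => η j / (√(d' j) : ℝ))
  simp only [weight_mul (hd _), weight_mul (hd' _)] at this
  simpa only [Complex.ofReal_mul, div_mul_div_comm, ← mul_div_assoc, div_mul_eq_mul_div, div_div]
    using this

lemma re_sum_mul_le_of_forall_isContractiveForm {k Φ : ι → κ → ℂ} {C : ℝ} (hC : 0 ≤ C)
    (hΦ : ∀ β : ι → κ → ℂ, IsContractiveForm β → ∀ (a : ι → ℝ) (c : κ → ℝ),
      ‖∑ i, ∑ j, β i j * (a i * c j * Φ i j)‖ ≤ C * (√(∑ i, a i ^ 2) * √(∑ j, c j ^ 2)))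
    {d : ι → ℝ} {d' : κ → ℝ} (hd : ∀ i, 0 < d i) (hd' : ∀ j, 0 < d' j)
    (hk : ∀ (ξ : ι → ℂ) (η : κ → ℂ), (∑ i, ∑ j, k i j * (ξ i * η j)).re
      ≤ ∑ i, d i * ‖ξ i‖ ^ 2 + ∑ j, d' j * ‖η j‖ ^ 2) :
    (∑ i, ∑ j, k i j * Φ i j).re ≤ (∑ i, d i + ∑ j, d' j) * C := by
  have bound := hΦ _ (isContractiveForm_of_weighted hd hd' hk) (fun i => √(d i)) (fun j => √(d' j))
  have sum_eq : ∑ i, ∑ j, k i j / (√(d i) * √(d' j) : ℝ) / 2 * (√(d i) * √(d' j) * Φ i j)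
      = (∑ i, ∑ j, k i j * Φ i j) / 2 := by
    simp only [Finset.sum_div]
    refine Finset.sum_congr rfl fun i _ => Finset.sum_congr rfl fun j _ => ?_
    have := Complex.ofReal_ne_zero.2 (Real.sqrt_pos.2 (hd i)).ne'
    have := Complex.ofReal_ne_zero.2 (Real.sqrt_pos.2 (hd' j)).ne'
    push_cast
    field_simp
  simp only [Real.sq_sqrt (hd _).le, Real.sq_sqrt (hd' _).le, sum_eq, norm_div,
    Complex.norm_ofNat] at bound
  have am_gm : 2 * √(∑ i, d i) * √(∑ j, d' j) ≤ ∑ i, d i + ∑ j, d' j := by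
    refine (two_mul_le_add_sq _ _).trans_eq (congrArg₂ _ ?_ ?_)
    · exact Real.sq_sqrt (Finset.sum_nonneg fun i _ => (hd i).le)
    · exact Real.sq_sqrt (Finset.sum_nonneg fun j _ => (hd' j).le)
  linarith [Complex.re_le_norm (∑ i, ∑ j, k i j * Φ i j), mul_le_mul_of_nonneg_right am_gm hC]

/-- By duality: a functional separating `Φ` from the Gram cone rescales to a contractive form. -/
lemma hasGramFactorization_of_forall_isContractiveForm {Φ : ι → κ → ℂ} {C : ℝ} (hC : 0 ≤ C)
    (h : ∀ β : ι → κ → ℂ, IsContractiveForm β → ∀ (a : ι → ℝ) (c : κ → ℝ),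
      ‖∑ i, ∑ j, β i j * (a i * c j * Φ i j)‖ ≤ C * (√(∑ i, a i ^ 2) * √(∑ j, c j ^ 2))) :
    HasGramFactorization (fun _ => C) Φ := by
  by_contra not_factorization
  obtain ⟨d, k, d_nonneg, k_le, separation⟩ :=
    exists_dual_of_not_hasGramFactorization not_factorization
  rw [← Finset.sum_mul, Fintype.sum_sum_type] at separation
  have perturbed {ε : ℝ} (hε : 0 < ε) : (∑ i, ∑ j, k i j * Φ i j).re
      ≤ (∑ i, (d (.inl i) + ε) + ∑ j, (d (.inr j) + ε)) * C := by
    have d_add_pos (p : ι ⊕ κ) : 0 < d p + ε := add_pos_of_nonneg_of_pos (d_nonneg p) hε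
    refine re_sum_mul_le_of_forall_isContractiveForm hC h (fun i => d_add_pos (.inl i))
      (fun j => d_add_pos (.inr j)) fun ξ η => (k_le ξ η).trans ?_
    gcongr <;> exact le_add_of_nonneg_right hε.le
  have perturbed_tendsto :
      Tendsto (fun ε : ℝ => (∑ i, (d (.inl i) + ε) + ∑ j, (d (.inr j) + ε)) * C) (𝓝[>] 0)
        (𝓝 ((∑ i, d (.inl i) + ∑ j, d (.inr j)) * C)) := by
    have continuous :
      Continuous fun ε : ℝ => (∑ i, (d (.inl i) + ε) + ∑ j, (d (.inr j) + ε)) * C := by fun_prop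
    simpa only [add_zero] using (continuous.tendsto 0).mono_left nhdsWithin_le_nhds
  exact separation.not_ge
    (ge_of_tendsto perturbed_tendsto (eventually_mem_nhdsWithin.mono fun _ => perturbed))

end FiniteFactorization

section UniformBoundedness

/-- The Banach–Steinhaus theorem is used twice: for the forms `f i x · y` with `y` fixed, and then
for the functionals `f i x` with `x` in the unit ball. -/
lemma exists_norm_le_of_separately_continuous {ι E F : Type*} [NormedAddCommGroup E]
    [NormedSpace ℂ E] [CompleteSpace E] [NormedAddCommGroup F] [NormedSpace ℂ F] [CompleteSpace F]
    {f : ι → E → F → ℂ} (hright : ∀ i x, ∃ L : F →L[ℂ] ℂ, ∀ y, L y = f i x y)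
    (hleft : ∀ i y, ∃ R : E →L[ℂ] ℂ, ∀ x, R x = f i x y)
    (hbound : ∀ x y, ∃ C, ∀ i, ‖f i x y‖ ≤ C) :
    ∃ C : ℝ≥0, ∀ i x y, ‖f i x y‖ ≤ C * ‖x‖ * ‖y‖ := by
  choose L hL using hright
  choose R hR using hleft
  obtain ⟨C, hC⟩ := banach_steinhaus (ι := ι × {x : E // ‖x‖ = 1})
      (g := fun q => L q.1 q.2) fun y => by
    obtain ⟨M, hM⟩ := banach_steinhaus (g := fun i => R i y) (by simpa only [hR] using (hbound · y))
    refine ⟨M, fun q => ?_⟩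
    rw [hL, ← hR]
    exact (R q.1 y).le_of_opNorm_le_of_le (hM q.1) q.2.2.le |>.trans_eq (mul_one M)
  refine ⟨C.toNNReal, fun i x y => ?_⟩
  have norm_R_le : ‖R i y‖ ≤ C.toNNReal * ‖y‖ :=
    ContinuousLinearMap.opNorm_le_of_unit_norm (by positivity) fun x hx => by
      rw [hR, ← hL]
      exact (L i x).le_of_opNorm_le ((hC (i, ⟨x, hx⟩)).trans (Real.le_coe_toNNReal C)) y
  rw [← hR, mul_right_comm]
  exact (R i y).le_of_opNorm_le norm_R_le x

/-- By the closed graph theorem: convergence in `L^p` implies convergence almost everywhere along a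
subsequence, so the graph of `g ↦ k · (g ∘ r)` is closed. -/
lemma exists_clm_eq_integral_mul_comp {α β : Type*} [MeasurableSpace α] [MeasurableSpace β]
    {m : Measure α} {n : Measure β} {r : α → β} (hr : Measure.QuasiMeasurePreserving r m n)
    {p : ℝ≥0∞} [Fact (1 ≤ p)] {k : α → ℂ}
    (hk : ∀ g : Lp ℂ p n, Integrable (fun a => k a * g (r a)) m) :
    ∃ L : Lp ℂ p n →L[ℂ] ℂ, ∀ g, L g = ∫ a, k a * g (r a) ∂m := by
  let T : Lp ℂ p n →ₗ[ℂ] Lp ℂ 1 m :=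
    { toFun g := (hk g).toL1
      map_add' g g' := by
        rw [← Integrable.toL1_add, Integrable.toL1_eq_toL1_iff]
        filter_upwards [hr.ae (Lp.coeFn_add g g')] with a add_apply
        rw [add_apply, Pi.add_apply, Pi.add_apply, mul_add]
      map_smul' c g := by
        rw [RingHom.id_apply, ← Integrable.toL1_smul', Integrable.toL1_eq_toL1_iff]
        filter_upwards [hr.ae (Lp.coeFn_smul c g)] with a smul_apply
        rw [smul_apply, Pi.smul_apply, Pi.smul_apply, smul_eq_mul, smul_eq_mul, mul_left_comm] }
  have closed_graph (g : ℕ → Lp ℂ p n) (g₀ : Lp ℂ p n) (z : Lp ℂ 1 m)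
      (hg : Tendsto g atTop (𝓝 g₀)) (hz : Tendsto (T ∘ g) atTop (𝓝 z)) : z = T g₀ := by
    obtain ⟨σ, hσ, tendsto_g⟩ := (tendstoInMeasure_of_tendsto_Lp hg).exists_seq_tendsto_ae
    obtain ⟨τ, hτ, tendsto_T⟩ :=
      (tendstoInMeasure_of_tendsto_Lp (hz.comp hσ.tendsto_atTop)).exists_seq_tendsto_ae
    refine Lp.ext ?_
    filter_upwards [hr.ae tendsto_g, tendsto_T, (hk g₀).coeFn_toL1,
      ae_all_iff.2 fun i => (hk (g (σ (τ i)))).coeFn_toL1] with a lim_g lim_T T_g₀ T_g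
    refine tendsto_nhds_unique lim_T ?_
    simp only [comp_apply, T, LinearMap.coe_mk, AddHom.coe_mk, T_g₀, T_g]
    exact (lim_g.comp hτ.tendsto_atTop).const_mul (k a)
  refine ⟨L1.integralCLM' ℂ ∘L .ofSeqClosedGraph closed_graph, fun g => ?_⟩
  exact (L1.integral_eq' ℂ _).symm.trans ((L1.integral_eq_integral _).trans
    (integral_congr_ae (hk g).coeFn_toL1))

end UniformBoundedness

section BilinearBound

variable {S : Type u} {T : Type v} [MeasurableSpace S] [MeasurableSpace T]
  {μ : Measure S} {ν : Measure T} [SigmaFinite μ] [SigmaFinite ν]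

lemma traceNorm_integralOperator_mul_prod_le {a : S → ℂ} {c : T → ℂ} (ha : MemLp a 2 μ)
    (hc : MemLp c 2 ν) :
    traceNorm (integralOperator (fun p : S × T => a p.1 * c p.2) (memLp_two_mul_prod ha hc))
      ≤ eLpNorm a 2 μ * eLpNorm c 2 ν := by
  have expansion : IsNuclearExpansion
      (integralOperator (fun p : S × T => a p.1 * c p.2) (memLp_two_mul_prod ha hc))
      (fun _ : Unit => ha.toLp a) (fun _ => hc.star.toLp _) := fun x y => by
    convert hasSum_fintype _ using 1
    rw [inner_integralOperator, Fintype.sum_unique, L2.inner_def, L2.inner_def, mul_comm,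
      ← integral_prod_mul]
    refine integral_congr_ae ?_
    filter_upwards [Measure.quasiMeasurePreserving_fst.ae ha.coeFn_toLp,
      Measure.quasiMeasurePreserving_snd.ae hc.star.coeFn_toLp] with p a_apply c_apply
    rw [a_apply, c_apply, RCLike.inner_apply, RCLike.inner_apply, Pi.star_apply, RCLike.star_def,
      RCLike.conj_conj]
    ring
  refine expansion.traceNorm_le.trans_eq ?_
  rw [tsum_fintype, Fintype.sum_unique, Lp.enorm_toLp, Lp.enorm_toLp]
  congr 1
  exact eLpNorm_congr_norm_ae (.of_forall fun t => norm_star (c t))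

/-- The square integrable kernels `b` which pair with the trace class integral operators as
elements of the unit ball of the dual: `|∫ g b| ≤ ‖I_g‖_{S₁}`. -/
def contractiveKernels (μ : Measure S) (ν : Measure T) [SigmaFinite μ] [SigmaFinite ν] :
    Set (S × T → ℂ) :=
  {b | MemLp b 2 (μ.prod ν) ∧ ∀ (g : S × T → ℂ) (hg : MemLp g 2 (μ.prod ν)),
    ‖∫ p, g p * b p ∂(μ.prod ν)‖ₑ ≤ traceNorm (integralOperator g hg)}

/-- The Schur multiplier inequality for kernels of rank one, in dual form: the trace norm of
`I_{Φ · (a ⊗ c)}` is tested against the contractive kernels. -/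
def HasBilinearBound (μ : Measure S) (ν : Measure T) [SigmaFinite μ] [SigmaFinite ν]
    (Φ : S × T → ℂ) (C : ℝ≥0) : Prop :=
  ∀ (a : S → ℂ) (c : T → ℂ), MemLp a 2 μ → MemLp c 2 ν →
    MemLp (fun p => Φ p * (a p.1 * c p.2)) 2 (μ.prod ν) ∧
    ∀ b ∈ contractiveKernels μ ν, ‖∫ p, Φ p * (a p.1 * c p.2) * b p ∂(μ.prod ν)‖ₑ
      ≤ C * (eLpNorm a 2 μ * eLpNorm c 2 ν)

variable {Φ : S × T → ℂ} {C : ℝ≥0}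

lemma IsSchurBound.hasBilinearBound (h : IsSchurBound μ ν Φ C) : HasBilinearBound μ ν Φ C := by
  intro a c ha hc
  have traceNorm_le := traceNorm_integralOperator_mul_prod_le ha hc
  obtain ⟨memLp, schur_le⟩ := h _ (memLp_two_mul_prod ha hc)
    (traceNorm_le.trans_lt (ENNReal.mul_lt_top ha.2 hc.2))
  exact ⟨memLp, fun b hb => (hb.2 _ memLp).trans (schur_le.trans (by gcongr))⟩

lemma IsSchurMultiplier.memLp_mul_prod (h : IsSchurMultiplier μ ν Φ) {a : S → ℂ} {c : T → ℂ}
    (ha : MemLp a 2 μ) (hc : MemLp c 2 ν) :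
    ∃ hΦ : MemLp (fun p => Φ p * (a p.1 * c p.2)) 2 (μ.prod ν),
      IsTraceClass (integralOperator _ hΦ) :=
  h.2 _ (memLp_two_mul_prod ha hc) ((traceNorm_integralOperator_mul_prod_le ha hc).trans_lt
    (ENNReal.mul_lt_top ha.2 hc.2))

lemma IsSchurMultiplier.exists_norm_integral_le (h : IsSchurMultiplier μ ν Φ) :
    ∃ C : ℝ≥0, ∀ b ∈ contractiveKernels μ ν, ∀ (a : Lp ℂ 2 μ) (c : Lp ℂ 2 ν),
      ‖∫ p, Φ p * (a p.1 * c p.2) * b p ∂(μ.prod ν)‖ ≤ C * ‖a‖ * ‖c‖ := by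
  have integrable (b : contractiveKernels μ ν) (a : Lp ℂ 2 μ) (c : Lp ℂ 2 ν) :
      Integrable (fun p => Φ p * (a p.1 * c p.2) * b.1 p) (μ.prod ν) :=
    (h.memLp_mul_prod (Lp.memLp a) (Lp.memLp c)).1.integrable_mul b.2.1
  refine (exists_norm_le_of_separately_continuous
    (f := fun (b : contractiveKernels μ ν) (a : Lp ℂ 2 μ) (c : Lp ℂ 2 ν) =>
      ∫ p, Φ p * (a p.1 * c p.2) * b.1 p ∂(μ.prod ν))
    (fun b a => ?_) (fun b c => ?_) fun a c => ?_).imp fun C hC b hb => hC ⟨b, hb⟩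
  · have move_c (c : T → ℂ) (p : S × T) :
        Φ p * (a p.1 * c p.2) * b.1 p = Φ p * a p.1 * b.1 p * c p.2 := by ring
    simp only [move_c]
    exact exists_clm_eq_integral_mul_comp Measure.quasiMeasurePreserving_snd fun c =>
      (integrable b a c).congr (.of_forall (move_c c))
  · have move_a (a : S → ℂ) (p : S × T) :
        Φ p * (a p.1 * c p.2) * b.1 p = Φ p * c p.2 * b.1 p * a p.1 := by ring
    simp only [move_a]
    exact exists_clm_eq_integral_mul_comp Measure.quasiMeasurePreserving_fst fun a =>
      (integrable b a c).congr (.of_forall (move_a a))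
  · obtain ⟨memLp, trace_class⟩ := h.memLp_mul_prod (Lp.memLp a) (Lp.memLp c)
    refine ⟨(traceNorm (integralOperator _ memLp)).toReal, fun b => ?_⟩
    rw [← toReal_enorm]
    exact ENNReal.toReal_mono trace_class.ne (b.2.2 _ memLp)

lemma IsSchurMultiplier.exists_hasBilinearBound (h : IsSchurMultiplier μ ν Φ) :
    ∃ C : ℝ≥0, HasBilinearBound μ ν Φ C := by
  obtain ⟨C, hC⟩ := h.exists_norm_integral_le
  refine ⟨C, fun a c ha hc => ⟨(h.memLp_mul_prod ha hc).1, fun b hb => ?_⟩⟩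
  have toLp_eq : ∫ p, Φ p * (ha.toLp a p.1 * hc.toLp c p.2) * b p ∂(μ.prod ν)
      = ∫ p, Φ p * (a p.1 * c p.2) * b p ∂(μ.prod ν) := by
    refine integral_congr_ae ?_
    filter_upwards [Measure.quasiMeasurePreserving_fst.ae ha.coeFn_toLp,
      Measure.quasiMeasurePreserving_snd.ae hc.coeFn_toLp] with p a_apply c_apply
    rw [a_apply, c_apply]
  have norm_le := hC b hb (ha.toLp a) (hc.toLp c)
  rw [toLp_eq, Lp.norm_toLp, Lp.norm_toLp] at norm_le
  rw [← ofReal_norm, ENNReal.ofReal_le_iff_le_toReal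
    (ENNReal.mul_ne_top ENNReal.coe_ne_top (ENNReal.mul_ne_top ha.2.ne hc.2.ne))]
  rwa [ENNReal.toReal_mul, ENNReal.toReal_mul, ENNReal.coe_toReal, ← mul_assoc]

end BilinearBound

/-- Pairwise orthogonal vectors of norm at most one. Zero vectors are allowed, so that a finite or
infinite orthonormal system can be padded to any index type. -/
structure IsSuborthonormal (𝕜 : Type*) [RCLike 𝕜] {E : Type*} [NormedAddCommGroup E]
    [InnerProductSpace 𝕜 E] {ι : Type*} (e : ι → E) : Prop where
  pairwise_inner : Pairwise fun i j => ⟪e i, e j⟫_𝕜 = 0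
  norm_le_one : ∀ i, ‖e i‖ ≤ 1

namespace IsSuborthonormal

variable {𝕜 : Type*} [RCLike 𝕜] {E : Type*} [NormedAddCommGroup E] [InnerProductSpace 𝕜 E]
  {ι : Type*} {e : ι → E}

lemma norm_sum_smul_sq_le (he : IsSuborthonormal 𝕜 e) (s : Finset ι) (z : ι → 𝕜) :
    ‖∑ i ∈ s, z i • e i‖ ^ 2 ≤ ∑ i ∈ s, ‖z i‖ ^ 2 := by
  rw [← inner_self_eq_norm_sq (𝕜 := 𝕜), inner_sum, map_sum]
  refine Finset.sum_le_sum fun i hi => ?_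
  rw [sum_inner, Finset.sum_eq_single_of_mem i hi fun j _ hj => by
    rw [inner_smul_left, inner_smul_right, he.pairwise_inner hj, mul_zero, mul_zero],
    inner_self_eq_norm_sq, norm_smul, mul_pow]
  exact mul_le_of_le_one_right (sq_nonneg _) (pow_le_one₀ (norm_nonneg _) (he.norm_le_one i))

lemma sum_norm_inner_sq_le (he : IsSuborthonormal 𝕜 e) (s : Finset ι) (x : E) :
    ∑ i ∈ s, ‖⟪e i, x⟫_𝕜‖ ^ 2 ≤ ‖x‖ ^ 2 := by
  have inner_eq : RCLike.re ⟪x, ∑ i ∈ s, ⟪e i, x⟫_𝕜 • e i⟫_𝕜 = ∑ i ∈ s, ‖⟪e i, x⟫_𝕜‖ ^ 2 := by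
    rw [inner_sum, map_sum]
    refine Finset.sum_congr rfl fun i _ => ?_
    rw [inner_smul_right, inner_mul_symm_re_eq_norm, norm_mul, norm_inner_symm x, sq]
  have norm_le := he.norm_sum_smul_sq_le s fun i => ⟪e i, x⟫_𝕜
  have sub_nonneg := sq_nonneg ‖x - ∑ i ∈ s, ⟪e i, x⟫_𝕜 • e i‖
  rw [norm_sub_sq (𝕜 := 𝕜), inner_eq] at sub_nonneg
  linarith

lemma tsum_enorm_inner_sq_le (he : IsSuborthonormal 𝕜 e) (x : E) :
    ∑' i, ‖⟪e i, x⟫_𝕜‖ₑ ^ 2 ≤ ‖x‖ₑ ^ 2 := by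
  rw [ENNReal.tsum_eq_iSup_sum]
  refine iSup_le fun s => ?_
  simp only [← ofReal_norm, ← ENNReal.ofReal_pow (norm_nonneg _)]
  rw [← ENNReal.ofReal_sum_of_nonneg fun _ _ => sq_nonneg _]
  exact ENNReal.ofReal_le_ofReal (he.sum_norm_inner_sq_le s x)

end IsSuborthonormal

lemma IsContractiveForm.enorm_sum_inner_le {ι κ E F : Type*} [Fintype ι] [Fintype κ]
    [NormedAddCommGroup E] [InnerProductSpace ℂ E] [CompleteSpace E] [NormedAddCommGroup F]
    [InnerProductSpace ℂ F] [CompleteSpace F] {β : ι → κ → ℂ} (hβ : IsContractiveForm β)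
    {e : ι → F} {f : κ → E} (he : IsSuborthonormal ℂ e) (hf : IsSuborthonormal ℂ f)
    (A : E →L[ℂ] F) : ‖∑ i, ∑ j, β i j * ⟪e i, A (f j)⟫_ℂ‖ₑ ≤ traceNorm A := by
  obtain ⟨u, v, expansion, sum_u_le, sum_v_le⟩ := exists_isNuclearExpansion A
  have hasSum : HasSum (fun k => ∑ i, ∑ j, β i j * (⟪v k, f j⟫_ℂ * ⟪e i, u k⟫_ℂ))
      (∑ i, ∑ j, β i j * ⟪e i, A (f j)⟫_ℂ) :=
    hasSum_sum fun i _ => hasSum_sum fun j _ => (expansion (f j) (e i)).mul_left _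
  have term_le (k : onbIndex E) :
      ‖∑ i, ∑ j, β i j * (⟪v k, f j⟫_ℂ * ⟪e i, u k⟫_ℂ)‖ ≤ ‖u k‖ * ‖v k‖ := by
    simp only [mul_comm ⟪v k, _⟫_ℂ]
    refine (hβ (fun i => ⟪e i, u k⟫_ℂ) fun j => ⟪v k, f j⟫_ℂ).trans ?_
    simp only [norm_inner_symm (v k)]
    gcongr
    · exact Real.sqrt_le_iff.2 ⟨norm_nonneg _, he.sum_norm_inner_sq_le _ _⟩
    · exact Real.sqrt_le_iff.2 ⟨norm_nonneg _, hf.sum_norm_inner_sq_le _ _⟩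
  rw [← hasSum.tsum_eq]
  calc ‖∑' k, ∑ i, ∑ j, β i j * (⟪v k, f j⟫_ℂ * ⟪e i, u k⟫_ℂ)‖ₑ
      ≤ ∑' k, ‖∑ i, ∑ j, β i j * (⟪v k, f j⟫_ℂ * ⟪e i, u k⟫_ℂ)‖ₑ := enorm_tsum_le_tsum_enorm
    _ ≤ ∑' k, ‖u k‖ₑ * ‖v k‖ₑ := ENNReal.tsum_le_tsum fun k => by
        simp only [← ofReal_norm, ← ENNReal.ofReal_mul (norm_nonneg _)]
        exact ENNReal.ofReal_le_ofReal (term_le k)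
    _ ≤ traceNorm A := tsum_mul_le_of_tsum_sq_le sum_u_le sum_v_le

section FiniteSums

variable {α ι κ : Type*} [MeasurableSpace α] {m : Measure α} [Fintype ι] [Fintype κ]

lemma coeFn_sum_smul {p : ℝ≥0∞} (z : ι → ℂ) (f : ι → Lp ℂ p m) :
    (∑ i, z i • f i : Lp ℂ p m) =ᵐ[m] fun a => ∑ i, z i * f i a := by
  filter_upwards [ae_all_iff.2 fun i => Lp.coeFn_smul (z i) (f i),
    Lp.coeFn_finsetSum Finset.univ fun i => z i • f i] with a smul_apply sum_apply
  rw [sum_apply, Finset.sum_apply]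
  exact Finset.sum_congr rfl fun i _ => smul_apply i

lemma integral_sum_sum_const_mul (β : ι → κ → ℂ) {g : ι → κ → α → ℂ}
    (hg : ∀ i j, Integrable (g i j) m) :
    ∫ a, ∑ i, ∑ j, β i j * g i j a ∂m = ∑ i, ∑ j, β i j * ∫ a, g i j a ∂m := by
  rw [integral_finsetSum _ fun i _ => integrable_finsetSum _ fun j _ => (hg i j).const_mul _]
  refine Finset.sum_congr rfl fun i _ => ?_
  rw [integral_finsetSum _ fun j _ => (hg i j).const_mul _]
  exact Finset.sum_congr rfl fun j _ => integral_const_mul _ _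

end FiniteSums

/-- Square integrable functions with disjoint supports and norm at most one: the test functions
adapted to a grid. They are real valued, so that no conjugates appear in their squares. -/
structure IsDisjointFamily {α ι : Type*} [MeasurableSpace α] (m : Measure α) (e : ι → α → ℝ) :
    Prop where
  memLp : ∀ i, MemLp (fun a => (e i a : ℂ)) 2 m
  disjoint : ∀ i j, i ≠ j → ∀ a, e i a * e j a = 0
  norm_le : ∀ i, eLpNorm (fun a => (e i a : ℂ)) 2 m ≤ 1

namespace IsDisjointFamily

variable {α ι : Type*} [MeasurableSpace α] {m : Measure α} {e : ι → α → ℝ}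

lemma isSuborthonormal (he : IsDisjointFamily m e) :
    IsSuborthonormal ℂ fun i => (he.memLp i).toLp _ where
  pairwise_inner i j hij := by
    refine (L2.inner_def _ _).trans (integral_eq_zero_of_ae ?_)
    filter_upwards [(he.memLp i).coeFn_toLp, (he.memLp j).coeFn_toLp] with a i_apply j_apply
    rw [i_apply, j_apply, RCLike.inner_apply, Complex.conj_ofReal, ← Complex.ofReal_mul,
      he.disjoint j i hij.symm, Complex.ofReal_zero, Pi.zero_apply]
  norm_le_one i := by
    rw [Lp.norm_toLp]
    exact ENNReal.toReal_mono ENNReal.one_ne_top (he.norm_le i)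

variable [Fintype ι]

lemma memLp_sum (he : IsDisjointFamily m e) (z : ι → ℂ) :
    MemLp (fun a => ∑ i, z i * (e i a : ℂ)) 2 m :=
  memLp_finsetSum _ fun i _ => (he.memLp i).const_mul (z i)

lemma eLpNorm_sum_le (he : IsDisjointFamily m e) (z : ι → ℂ) :
    eLpNorm (fun a => ∑ i, z i * (e i a : ℂ)) 2 m ≤ ENNReal.ofReal √(∑ i, ‖z i‖ ^ 2) := by
  have ae_eq : (fun a => ∑ i, z i * (e i a : ℂ)) =ᵐ[m]
      ⇑(∑ i, z i • (he.memLp i).toLp _ : Lp ℂ 2 m) := by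
    filter_upwards [coeFn_sum_smul z fun i => (he.memLp i).toLp _,
      ae_all_iff.2 fun i => (he.memLp i).coeFn_toLp] with a sum_apply toLp_apply
    simp only [sum_apply, toLp_apply]
  rw [eLpNorm_congr_ae ae_eq, ← Lp.enorm_def, ← ofReal_norm]
  exact ENNReal.ofReal_le_ofReal (Real.le_sqrt_of_sq_le
    (he.isSuborthonormal.norm_sum_smul_sq_le Finset.univ z))

lemma sum_mul_apply (he : IsDisjointFamily m e) (z : ι → ℂ) (i : ι) (a : α) :
    (∑ j, z j * (e j a : ℂ)) * (e i a : ℂ) = z i * (e i a : ℂ) ^ 2 := by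
  rw [Finset.sum_mul, Finset.sum_eq_single i (fun j _ hj => ?_)
    (fun hi => absurd (Finset.mem_univ i) hi), mul_assoc, sq]
  rw [mul_assoc, ← Complex.ofReal_mul, he.disjoint j i hj, Complex.ofReal_zero, mul_zero]

end IsDisjointFamily

section StepFactorization

variable {S : Type u} {T : Type v} [MeasurableSpace S] [MeasurableSpace T]
  {μ : Measure S} {ν : Measure T} [SigmaFinite μ] [SigmaFinite ν]
  {ι κ : Type*} [Fintype ι] [Fintype κ] {e : ι → S → ℝ} {f : κ → T → ℝ}

lemma sum_kernel_mem_contractiveKernels (he : IsDisjointFamily μ e) (hf : IsDisjointFamily ν f)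
    {β : ι → κ → ℂ} (hβ : IsContractiveForm β) :
    (fun p : S × T => ∑ i, ∑ j, β i j * ((e i p.1 : ℂ) * (f j p.2 : ℂ)))
      ∈ contractiveKernels μ ν := by
  refine ⟨memLp_finsetSum _ fun i _ => memLp_finsetSum _ fun j _ =>
    (memLp_two_mul_prod (he.memLp i) (hf.memLp j)).const_mul _, fun g hg => ?_⟩
  have integral_eq : ∫ p, g p * ∑ i, ∑ j, β i j * ((e i p.1 : ℂ) * (f j p.2 : ℂ)) ∂(μ.prod ν)
      = ∑ i, ∑ j, β i j *
        ⟪(he.memLp i).toLp _, integralOperator g hg ((hf.memLp j).toLp _)⟫_ℂ := by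
    have mul_sum_eq (p : S × T) : g p * ∑ i, ∑ j, β i j * ((e i p.1 : ℂ) * (f j p.2 : ℂ))
        = ∑ i, ∑ j, β i j * (g p * ((e i p.1 : ℂ) * (f j p.2 : ℂ))) := by
      simp only [Finset.mul_sum, mul_left_comm (g p)]
    have inner_eq (i : ι) (j : κ) :
        ⟪(he.memLp i).toLp _, integralOperator g hg ((hf.memLp j).toLp _)⟫_ℂ
          = ∫ p, g p * ((e i p.1 : ℂ) * (f j p.2 : ℂ)) ∂(μ.prod ν) := by
      simpa only [Complex.conj_ofReal] using
        inner_integralOperator_of_ae_eq hg (he.memLp i).coeFn_toLp (hf.memLp j).coeFn_toLp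
    simp_rw [mul_sum_eq, inner_eq]
    exact integral_sum_sum_const_mul β fun i j =>
      (integrable_kernel_pairing hg (he.memLp i) (hf.memLp j) :)
  rw [integral_eq]
  exact hβ.enorm_sum_inner_le he.isSuborthonormal hf.isSuborthonormal _

/-- The functions `∑ a_i e_i` and `∑ c_j f_j` and the kernel `∑ β_ij e_i ⊗ f_j` are the tests which
produce the dual condition of `hasGramFactorization_of_forall_isContractiveForm`. -/
lemma HasBilinearBound.hasGramFactorization {Φ : S × T → ℂ} {C : ℝ≥0}
    (h : HasBilinearBound μ ν Φ C) (he : IsDisjointFamily μ e) (hf : IsDisjointFamily ν f) :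
    HasGramFactorization (fun _ => (C : ℝ)) fun i j =>
      ∫ p, Φ p * ((e i p.1 : ℂ) ^ 2 * (f j p.2 : ℂ) ^ 2) ∂(μ.prod ν) := by
  refine hasGramFactorization_of_forall_isContractiveForm C.coe_nonneg fun β hβ a c => ?_
  have integrable (i : ι) (j : κ) :
      Integrable (fun p => Φ p * ((e i p.1 : ℂ) ^ 2 * (f j p.2 : ℂ) ^ 2)) (μ.prod ν) := by
    refine ((h _ _ (he.memLp i) (hf.memLp j)).1.integrable_mul
      (memLp_two_mul_prod (he.memLp i) (hf.memLp j))).congr (.of_forall fun p => ?_)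
    simp only [Pi.mul_apply]
    ring
  have integrand_eq (p : S × T) :
      Φ p * ((∑ i, (a i : ℂ) * (e i p.1 : ℂ)) * ∑ j, (c j : ℂ) * (f j p.2 : ℂ))
        * ∑ i, ∑ j, β i j * ((e i p.1 : ℂ) * (f j p.2 : ℂ))
      = ∑ i, ∑ j, β i j * (a i * c j) * (Φ p * ((e i p.1 : ℂ) ^ 2 * (f j p.2 : ℂ) ^ 2)) := by
    rw [Finset.mul_sum]
    refine Finset.sum_congr rfl fun i _ => ?_
    rw [Finset.mul_sum]
    refine Finset.sum_congr rfl fun j _ => ?_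
    linear_combination β i j * Φ p * ((∑ j, (c j : ℂ) * (f j p.2 : ℂ)) * (f j p.2 : ℂ))
      * he.sum_mul_apply (fun i => (a i : ℂ)) i p.1
      + β i j * Φ p * (a i * (e i p.1 : ℂ) ^ 2) * hf.sum_mul_apply (fun j => (c j : ℂ)) j p.2
  have norm_le := (h _ _ (he.memLp_sum fun i => (a i : ℂ)) (hf.memLp_sum fun j => (c j : ℂ))).2 _
    (sum_kernel_mem_contractiveKernels he hf hβ)
  simp only [integrand_eq] at norm_le
  rw [integral_sum_sum_const_mul _ integrable] at norm_le
  simp only [mul_assoc] at norm_le ⊢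
  have eLpNorm_le := mul_le_mul' (he.eLpNorm_sum_le fun i => (a i : ℂ))
    (hf.eLpNorm_sum_le fun j => (c j : ℂ))
  simp only [Complex.norm_real, Real.norm_eq_abs, sq_abs] at eLpNorm_le
  rw [← ENNReal.ofReal_mul (Real.sqrt_nonneg _)] at eLpNorm_le
  refine (ENNReal.ofReal_le_ofReal_iff (by positivity)).1 ?_
  rw [ofReal_norm, ENNReal.ofReal_mul C.coe_nonneg, ENNReal.ofReal_coe_nnreal]
  exact norm_le.trans (by gcongr)

end StepFactorization

section GramLimit

variable {V J : Type*} [NormedAddCommGroup V] [InnerProductSpace ℂ V] {H : J → Type*}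
  [∀ j, NormedAddCommGroup (H j)] [∀ j, InnerProductSpace ℂ (H j)] {z : ∀ j, V →ₗ[ℂ] H j} {K : ℝ}

lemma exists_sesquilinear_tendsto_inner (U : Ultrafilter J)
    (hz : ∀ j v, ‖z j v‖ ≤ K * ‖v‖) :
    ∃ B : V →L⋆[ℂ] V →L[ℂ] ℂ, ∀ v w, Tendsto (fun j => ⟪z j v, z j w⟫_ℂ) U (𝓝 (B v w)) := by
  have exists_limit (v w : V) : ∃ N ∈ Metric.closedBall (0 : ℂ) (K ^ 2 * ‖v‖ * ‖w‖),
      Tendsto (fun j => ⟪z j v, z j w⟫_ℂ) U (𝓝 N) := by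
    refine (isCompact_closedBall (0 : ℂ) (K ^ 2 * ‖v‖ * ‖w‖)).ultrafilter_le_nhds
      (U.map fun j => ⟪z j v, z j w⟫_ℂ) (le_principal_iff.2 (mem_map.2 (univ_mem' fun j => ?_)))
    rw [Set.mem_preimage, mem_closedBall_zero_iff]
    calc ‖⟪z j v, z j w⟫_ℂ‖ ≤ ‖z j v‖ * ‖z j w‖ := norm_inner_le_norm _ _
      _ ≤ (K * ‖v‖) * (K * ‖w‖) :=
        mul_le_mul (hz j v) (hz j w) (norm_nonneg _) ((norm_nonneg _).trans (hz j v))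
      _ = K ^ 2 * ‖v‖ * ‖w‖ := by ring
  choose N mem_closedBall tendsto using exists_limit
  refine ⟨LinearMap.mkContinuous₂ (LinearMap.mk₂'ₛₗ _ _ N
    (fun v v' w => tendsto_nhds_unique (tendsto _ _) ?_)
    (fun c v w => tendsto_nhds_unique (tendsto _ _) ?_)
    (fun v w w' => tendsto_nhds_unique (tendsto _ _) ?_)
    (fun c v w => tendsto_nhds_unique (tendsto _ _) ?_)) (K ^ 2)
    fun v w => mem_closedBall_zero_iff.1 (mem_closedBall v w), tendsto⟩
  · simpa only [map_add, inner_add_left] using (tendsto v w).add (tendsto v' w)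
  · simpa only [map_smul, inner_smul_left, smul_eq_mul] using
      (tendsto v w).const_mul (starRingEnd ℂ c)
  · simpa only [map_add, inner_add_right] using (tendsto v w).add (tendsto v w')
  · simpa only [map_smul, inner_smul_right, smul_eq_mul, RingHom.id_apply] using
      (tendsto v w).const_mul c

/-- The limit form is positive, so it is the Gram form of the square root of its operator. -/
lemma exists_clm_tendsto_inner [CompleteSpace V] (U : Ultrafilter J)
    (hz : ∀ j v, ‖z j v‖ ≤ K * ‖v‖) :
    ∃ Z : V →L[ℂ] V, ∀ v w, Tendsto (fun j => ⟪z j v, z j w⟫_ℂ) U (𝓝 ⟪Z v, Z w⟫_ℂ) := by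
  open scoped ComplexOrder in
  obtain ⟨B, tendsto⟩ := exists_sesquilinear_tendsto_inner U hz
  let A : V →L[ℂ] V := InnerProductSpace.continuousLinearMapOfBilin B
  have inner_A (v w : V) : ⟪A v, w⟫_ℂ = B v w :=
    InnerProductSpace.continuousLinearMapOfBilin_apply B v w
  have A_nonneg : 0 ≤ A := by
    rw [ContinuousLinearMap.nonneg_iff_isPositive, ContinuousLinearMap.isPositive_iff_complex]
    intro v
    have B_nonneg : 0 ≤ B v v := ge_of_tendsto' (tendsto v v) fun j => by
      rw [inner_self_eq_norm_sq_to_K]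
      positivity
    rw [inner_A]
    exact ⟨(Complex.eq_re_of_ofReal_le B_nonneg).symm, (Complex.nonneg_iff.1 B_nonneg).1⟩
  refine ⟨CFC.sqrt A, fun v w => ?_⟩
  rw [inner_sqrt_apply_sqrt_apply A_nonneg,
    ← ((ContinuousLinearMap.nonneg_iff_isPositive A).1 A_nonneg).inner_left_eq_inner_right, inner_A]
  exact tendsto v w

end GramLimit

section SqWeighted

variable {α : Type*} [MeasurableSpace α] {m : Measure α} {ρ : α → ℝ≥0}

/-- The measure `ρ² dm`. For a positive square integrable `ρ` it is finite and has the same null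
sets as `m`, which reduces the σ-finite case to the finite one. -/
noncomputable def sqWeighted (m : Measure α) (ρ : α → ℝ≥0) : Measure α :=
  m.withDensity fun a => (ρ a : ℝ≥0∞) ^ 2

lemma sqWeighted_absolutelyContinuous (m : Measure α) (ρ : α → ℝ≥0) : sqWeighted m ρ ≪ m :=
  withDensity_absolutelyContinuous _ _

lemma absolutelyContinuous_sqWeighted (hρ : Measurable ρ) (ρ_pos : ∀ a, 0 < ρ a) :
    m ≪ sqWeighted m ρ :=
  withDensity_absolutelyContinuous' (hρ.coe_nnreal_ennreal.pow_const 2).aemeasurable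
    (.of_forall fun a => pow_ne_zero 2 (ENNReal.coe_ne_zero.2 (ρ_pos a).ne'))

lemma eLpNorm_two_sq_coe (m : Measure α) (ρ : α → ℝ≥0) :
    eLpNorm (fun a => ((ρ a : ℝ) : ℂ)) 2 m ^ 2 = sqWeighted m ρ Set.univ := by
  rw [eLpNorm_two_sq, sqWeighted, withDensity_apply _ .univ, setLIntegral_univ]
  simp only [← ofReal_norm, Complex.norm_real, NNReal.norm_eq, ENNReal.ofReal_coe_nnreal]

lemma memLp_two_coe_of_isFiniteMeasure_sqWeighted (hρ : Measurable ρ)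
    [IsFiniteMeasure (sqWeighted m ρ)] : MemLp (fun a => ((ρ a : ℝ) : ℂ)) 2 m := by
  refine ⟨(Complex.measurable_ofReal.comp hρ.coe_nnreal_real).aestronglyMeasurable,
    (ENNReal.pow_lt_top_iff.1 ?_).resolve_right two_ne_zero⟩
  rw [eLpNorm_two_sq_coe]
  exact measure_lt_top _ _

lemma exists_isFiniteMeasure_sqWeighted (m : Measure α) [SigmaFinite m] :
    ∃ ρ : α → ℝ≥0, Measurable ρ ∧ (∀ a, 0 < ρ a) ∧ IsFiniteMeasure (sqWeighted m ρ) := by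
  obtain ⟨g, g_pos, measurable_g, integral_g⟩ :=
    exists_pos_lintegral_lt_of_sigmaFinite m one_ne_zero
  refine ⟨fun a => NNReal.sqrt (g a), NNReal.continuous_sqrt.measurable.comp measurable_g,
    fun a => NNReal.sqrt_pos.2 (g_pos a), isFiniteMeasure_withDensity ?_⟩
  simp only [← ENNReal.coe_pow, NNReal.sq_sqrt]
  exact integral_g.ne_top

lemma integral_sqWeighted (hρ : Measurable ρ) (f : α → ℂ) :
    ∫ a, f a ∂(sqWeighted m ρ) = ∫ a, (ρ a : ℂ) ^ 2 * f a ∂m := by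
  simp only [sqWeighted, ← ENNReal.coe_pow]
  rw [integral_withDensity_eq_integral_smul (hρ.pow_const 2)]
  simp only [NNReal.smul_def, Complex.real_smul, NNReal.coe_pow, Complex.ofReal_pow]

lemma memLp_two_sqWeighted (hρ : Measurable ρ) {f : α → ℂ} (hf : AEStronglyMeasurable f m)
    (hfρ : MemLp (fun a => f a * (ρ a : ℝ)) 2 m) : MemLp f 2 (sqWeighted m ρ) := by
  refine ⟨hf.mono_ac (sqWeighted_absolutelyContinuous m ρ),
    (ENNReal.pow_lt_top_iff.1 ?_).resolve_right two_ne_zero⟩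
  have weighted_lt_top : eLpNorm (fun a => f a * (ρ a : ℝ)) 2 m ^ 2 < ∞ :=
    ENNReal.pow_lt_top hfρ.2
  rw [eLpNorm_two_sq] at weighted_lt_top ⊢
  rw [sqWeighted, lintegral_withDensity_eq_lintegral_mul₀ (by fun_prop) (hf.enorm.pow_const 2)]
  refine lt_of_eq_of_lt (lintegral_congr fun a => ?_) weighted_lt_top
  rw [Pi.mul_apply, enorm_mul, mul_pow, mul_comm]
  simp only [← ofReal_norm, Complex.norm_real, NNReal.norm_eq, ENNReal.ofReal_coe_nnreal]

/-- The function `ρ` cut off to a set and divided by its `L²` norm there. It vanishes when that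
norm does, by the convention for division by zero. -/
noncomputable def normalizedPiece (m : Measure α) (ρ : α → ℝ≥0) (A : Set α) : α → ℝ :=
  A.indicator fun a => ρ a / √((sqWeighted m ρ).real A)

variable {A B : Set α}

lemma measurable_normalizedPiece (hρ : Measurable ρ) (hA : MeasurableSet A) :
    Measurable (normalizedPiece m ρ A) :=
  (hρ.coe_nnreal_real.div_const _).indicator hA

lemma normalizedPiece_mul_of_disjoint (hAB : Disjoint A B) (a : α) :
    normalizedPiece m ρ A a * normalizedPiece m ρ B a = 0 := by
  by_cases ha : a ∈ A
  · rw [normalizedPiece, normalizedPiece, Set.indicator_of_notMem (hAB.notMem_of_mem_left ha),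
      mul_zero]
  · rw [normalizedPiece, Set.indicator_of_notMem ha, zero_mul]

lemma normalizedPiece_sq (m : Measure α) (ρ : α → ℝ≥0) (A : Set α) (a : α) :
    normalizedPiece m ρ A a ^ 2
      = ((sqWeighted m ρ).real A)⁻¹ * A.indicator (fun a => (ρ a : ℝ) ^ 2) a := by
  by_cases ha : a ∈ A
  · rw [normalizedPiece, Set.indicator_of_mem ha, Set.indicator_of_mem ha, div_pow,
      Real.sq_sqrt measureReal_nonneg, div_eq_inv_mul]
  · rw [normalizedPiece, Set.indicator_of_notMem ha, Set.indicator_of_notMem ha, mul_zero,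
      zero_pow two_ne_zero]

lemma mul_normalizedPiece_sq (hA : (sqWeighted m ρ).real A ≠ 0) (a : α) :
    ((sqWeighted m ρ).real A : ℂ) * (normalizedPiece m ρ A a : ℂ) ^ 2
      = A.indicator (fun a => (ρ a : ℂ) ^ 2) a := by
  rw [← Complex.ofReal_pow, normalizedPiece_sq, ← Complex.ofReal_mul, mul_inv_cancel_left₀ hA]
  by_cases ha : a ∈ A
  · rw [Set.indicator_of_mem ha, Set.indicator_of_mem ha, Complex.ofReal_pow]
  · rw [Set.indicator_of_notMem ha, Set.indicator_of_notMem ha, Complex.ofReal_zero]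

lemma eLpNorm_normalizedPiece_le [IsFiniteMeasure (sqWeighted m ρ)] (hA : MeasurableSet A) :
    eLpNorm (fun a => (normalizedPiece m ρ A a : ℂ)) 2 m ≤ 1 := by
  have enorm_sq (a : α) : ‖(normalizedPiece m ρ A a : ℂ)‖ₑ ^ 2
      = ENNReal.ofReal ((sqWeighted m ρ).real A)⁻¹
        * A.indicator (fun a => (ρ a : ℝ≥0∞) ^ 2) a := by
    rw [← ofReal_norm, Complex.norm_real, ← ENNReal.ofReal_pow (norm_nonneg _), Real.norm_eq_abs,
      sq_abs, normalizedPiece_sq, ENNReal.ofReal_mul (inv_nonneg.2 measureReal_nonneg)]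
    by_cases ha : a ∈ A
    · rw [Set.indicator_of_mem ha, Set.indicator_of_mem ha, ENNReal.ofReal_pow NNReal.zero_le_coe,
        ENNReal.ofReal_coe_nnreal]
    · rw [Set.indicator_of_notMem ha, Set.indicator_of_notMem ha, ENNReal.ofReal_zero]
  rw [← ENNReal.pow_le_pow_left_iff two_ne_zero, eLpNorm_two_sq]
  simp only [enorm_sq]
  rw [lintegral_const_mul' _ _ ENNReal.ofReal_ne_top, lintegral_indicator hA,
    ← withDensity_apply _ hA, ← sqWeighted, ← ofReal_measureReal (measure_ne_top _ _),
    ← ENNReal.ofReal_mul (inv_nonneg.2 measureReal_nonneg), one_pow]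
  exact ENNReal.ofReal_le_one.2 inv_mul_le_one

lemma isDisjointFamily_normalizedPiece {ι : Type*} (hρ : Measurable ρ)
    [IsFiniteMeasure (sqWeighted m ρ)] {A : ι → Set α} (hA : ∀ i, MeasurableSet (A i))
    (disjoint : Pairwise (Disjoint on A)) :
    IsDisjointFamily m fun i => normalizedPiece m ρ (A i) where
  memLp i := ⟨(Complex.measurable_ofReal.comp
    (measurable_normalizedPiece hρ (hA i))).aestronglyMeasurable,
    (eLpNorm_normalizedPiece_le (hA i)).trans_lt ENNReal.one_lt_top⟩
  disjoint _ _ hij := normalizedPiece_mul_of_disjoint (disjoint hij)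
  norm_le i := eLpNorm_normalizedPiece_le (hA i)

end SqWeighted

section GridFactorization

variable {S : Type u} {T : Type v} [MeasurableSpace S] [MeasurableSpace T]
  {μ : Measure S} {ν : Measure T} {ρ : S → ℝ≥0} {θ : T → ℝ≥0}

lemma prod_sqWeighted [SFinite ν] (hρ : Measurable ρ) (hθ : Measurable θ) :
    (sqWeighted μ ρ).prod (sqWeighted ν θ)
      = sqWeighted (μ.prod ν) fun p => ρ p.1 * θ p.2 := by
  rw [sqWeighted, sqWeighted, prod_withDensity (hρ.coe_nnreal_ennreal.pow_const 2)
    (hθ.coe_nnreal_ennreal.pow_const 2), sqWeighted]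
  simp only [ENNReal.coe_mul, mul_pow]

/-- The averages of `Φ` over the cells of any finite measurable grid form a Gram matrix. -/
def HasGridFactorization (m : Measure S) (n : Measure T) (Φ : S × T → ℂ) (C : ℝ≥0) : Prop :=
  ∀ (ι : Type u) (κ : Type v) [Fintype ι] [Fintype κ] (A : ι → Set S) (B : κ → Set T),
    (∀ i, MeasurableSet (A i)) → (∀ j, MeasurableSet (B j)) →
    Pairwise (Disjoint on A) → Pairwise (Disjoint on B) →
    ∃ Ψ : ι → κ → ℂ, HasGramFactorization (fun _ => (C : ℝ)) Ψ ∧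
      ∀ i j, ∫ p in A i ×ˢ B j, Φ p ∂(m.prod n) = m.real (A i) * n.real (B j) * Ψ i j

lemma setIntegral_prod_eq_mul_integral_normalizedPiece [SFinite ν] (hρ : Measurable ρ)
    (hθ : Measurable θ) [IsFiniteMeasure (sqWeighted μ ρ)] [IsFiniteMeasure (sqWeighted ν θ)]
    (Φ : S × T → ℂ) {A : Set S} {B : Set T} (hA : MeasurableSet A) (hB : MeasurableSet B) :
    ∫ p in A ×ˢ B, Φ p ∂((sqWeighted μ ρ).prod (sqWeighted ν θ))
      = (sqWeighted μ ρ).real A * (sqWeighted ν θ).real B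
        * ∫ p, Φ p * ((normalizedPiece μ ρ A p.1 : ℂ) ^ 2
          * (normalizedPiece ν θ B p.2 : ℂ) ^ 2) ∂(μ.prod ν) := by
  by_cases null : (sqWeighted μ ρ).real A * (sqWeighted ν θ).real B = 0
  · rw [← Complex.ofReal_mul, null, Complex.ofReal_zero, zero_mul, setIntegral_measure_zero]
    rwa [← measureReal_eq_zero_iff, measureReal_prod_prod]
  rw [← integral_indicator (hA.prod hB), prod_sqWeighted hρ hθ,
    integral_sqWeighted (by fun_prop), ← integral_const_mul]
  refine integral_congr_ae (.of_forall fun p => ?_)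
  calc (ρ p.1 * θ p.2 : ℝ≥0) ^ 2 * (A ×ˢ B).indicator Φ p
      = Φ p * (A.indicator (fun s => (ρ s : ℂ) ^ 2) p.1
          * B.indicator (fun t => (θ t : ℂ) ^ 2) p.2) := by
        by_cases hp : p.1 ∈ A <;> by_cases hp' : p.2 ∈ B <;>
          simp [hp, hp', mul_pow, mul_comm]
    _ = (sqWeighted μ ρ).real A * (sqWeighted ν θ).real B
          * (Φ p * (normalizedPiece μ ρ A p.1 ^ 2 * normalizedPiece ν θ B p.2 ^ 2)) := by
        rw [← mul_normalizedPiece_sq (left_ne_zero_of_mul null),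
          ← mul_normalizedPiece_sq (right_ne_zero_of_mul null)]
        ring

lemma HasBilinearBound.hasGridFactorization [SigmaFinite μ] [SigmaFinite ν] {Φ : S × T → ℂ}
    {C : ℝ≥0} (h : HasBilinearBound μ ν Φ C) (hρ : Measurable ρ) (hθ : Measurable θ)
    [IsFiniteMeasure (sqWeighted μ ρ)] [IsFiniteMeasure (sqWeighted ν θ)] :
    HasGridFactorization (sqWeighted μ ρ) (sqWeighted ν θ) Φ C :=
  fun _ _ _ _ _ _ hA hB disjoint_A disjoint_B =>
    ⟨_, h.hasGramFactorization (isDisjointFamily_normalizedPiece hρ hA disjoint_A)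
      (isDisjointFamily_normalizedPiece hθ hB disjoint_B), fun i j =>
      setIntegral_prod_eq_mul_integral_normalizedPiece hρ hθ Φ (hA i) (hB j)⟩

end GridFactorization

section GridLimit

lemma integral_norm_le_mul_norm {α : Type*} [MeasurableSpace α] (m : Measure α)
    [IsFiniteMeasure m] (f : Lp ℂ 2 m) : ∫ a, ‖f a‖ ∂m ≤ √(m.real Set.univ) * ‖f‖ := by
  have holder := eLpNorm_le_eLpNorm_mul_rpow_measure_univ (p := 1) (q := 2) (μ := m) (by norm_num)
    (Lp.aestronglyMeasurable f)
  rw [integral_norm_eq_lintegral_enorm (Lp.aestronglyMeasurable f),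
    ← eLpNorm_one_eq_lintegral_enorm, mul_comm, Lp.norm_def, Real.sqrt_eq_rpow, measureReal_def,
    ENNReal.toReal_rpow, ← ENNReal.toReal_mul]
  refine ENNReal.toReal_mono (by finiteness [Lp.eLpNorm_ne_top f]) (holder.trans_eq ?_)
  norm_num

section GridMap

variable {α ι H : Type*} [MeasurableSpace α] {m : Measure α} [IsFiniteMeasure m] [Fintype ι]
  [NormedAddCommGroup H] [InnerProductSpace ℂ H] {A : ι → Set α}

/-- The linear map `f ↦ ∑ i, (∫_{A i} f) • w i`, which sends a function to its averages over the
cells `A i`, placed along the vectors `w i`. -/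
noncomputable def gridMap (m : Measure α) [IsFiniteMeasure m] (hA : ∀ i, MeasurableSet (A i))
    (w : ι → H) : Lp ℂ 2 m →ₗ[ℂ] H :=
  ∑ i, (innerₛₗ ℂ (indicatorConstLp 2 (hA i) (measure_ne_top m _) (1 : ℂ))).smulRight (w i)

lemma gridMap_apply (hA : ∀ i, MeasurableSet (A i)) (w : ι → H) (f : Lp ℂ 2 m) :
    gridMap m hA w f = ∑ i, (∫ a in A i, f a ∂m) • w i := by
  simp [gridMap, LinearMap.sum_apply, L2.inner_indicatorConstLp_one]

lemma norm_gridMap_le (hA : ∀ i, MeasurableSet (A i)) (disjoint : Pairwise (Disjoint on A))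
    {w : ι → H} {C : ℝ} (hw : ∀ i, ‖w i‖ ^ 2 ≤ C) (f : Lp ℂ 2 m) :
    ‖gridMap m hA w f‖ ≤ √C * ∫ a, ‖f a‖ ∂m := by
  have integrable : Integrable (fun a => ‖f a‖) m := ((Lp.memLp f).integrable one_le_two).norm
  rw [gridMap_apply]
  calc ‖∑ i, (∫ a in A i, f a ∂m) • w i‖
      ≤ ∑ i, (∫ a in A i, ‖f a‖ ∂m) * √C := norm_sum_le_of_le _ fun i _ => by
        rw [norm_smul]
        gcongr
        exacts [norm_integral_le_integral_norm _, Real.le_sqrt_of_sq_le (hw i)]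
    _ = √C * ∫ a in ⋃ i, A i, ‖f a‖ ∂m := by
        rw [← Finset.sum_mul, mul_comm,
          integral_iUnion_fintype hA disjoint fun _ => integrable.integrableOn]
    _ ≤ √C * ∫ a, ‖f a‖ ∂m := by
        refine mul_le_mul_of_nonneg_left ?_ (Real.sqrt_nonneg C)
        exact setIntegral_le_integral integrable (.of_forall fun _ => norm_nonneg _)

lemma gridMap_indicatorConstLp (hA : ∀ i, MeasurableSet (A i))
    (disjoint : Pairwise (Disjoint on A)) (w : ι → H) {B : Set α} (hB : MeasurableSet B)
    {I : Finset ι} (hBI : B = ⋃ i ∈ I, A i) :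
    gridMap m hA w (indicatorConstLp 2 hB (measure_ne_top m _) 1)
      = ∑ i ∈ I, (m.real (A i) : ℂ) • w i := by
  classical
  have inner_cell (i : ι) : (∫ a in A i, indicatorConstLp 2 hB (measure_ne_top m _) (1 : ℂ) a ∂m)
      = if i ∈ I then (m.real (A i) : ℂ) else 0 := by
    rw [← L2.inner_indicatorConstLp_one (hA i) (measure_ne_top m _),
      L2.inner_indicatorConstLp_one_indicatorConstLp_one (hA i) hB]
    split_ifs with hi
    · rw [Set.inter_eq_left.2 (hBI ▸ Set.subset_biUnion_of_mem hi)]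
      rfl
    · rw [hBI, Disjoint.inter_eq, measureReal_empty, RCLike.ofReal_zero]
      exact Set.disjoint_iUnion₂_right.2 fun j hj => disjoint fun eq => hi (eq ▸ hj)
  simp only [gridMap_apply, inner_cell, ite_smul, zero_smul, Finset.sum_ite_mem,
    Finset.univ_inter]

end GridMap

section PairLimit

lemma norm_le_of_tendsto_inner_self {J V : Type*} {H : J → Type*} [NormedAddCommGroup V]
    [InnerProductSpace ℂ V] [∀ j, NormedAddCommGroup (H j)] [∀ j, InnerProductSpace ℂ (H j)]
    {l : Filter J} [l.NeBot] {a : ∀ j, H j} {b : V} {c : ℝ}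
    (h : Tendsto (fun j => ⟪a j, a j⟫_ℂ) l (𝓝 ⟪b, b⟫_ℂ)) (ha : ∀ j, ‖a j‖ ≤ c) : ‖b‖ ≤ c := by
  obtain ⟨j⟩ := l.nonempty_of_neBot
  have norm_sq_tendsto : Tendsto (fun j => ‖a j‖ ^ 2) l (𝓝 (‖b‖ ^ 2)) := by
    simpa [inner_self_eq_norm_sq_to_K] using h.norm
  exact le_of_sq_le_sq (le_of_tendsto' norm_sq_tendsto fun j => by gcongr; exact ha j)
    ((norm_nonneg _).trans (ha j))

variable {J E F : Type*} {H : J → Type*} [NormedAddCommGroup E] [InnerProductSpace ℂ E]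
  [CompleteSpace E] [NormedAddCommGroup F] [InnerProductSpace ℂ F] [CompleteSpace F]
  [∀ j, NormedAddCommGroup (H j)] [∀ j, InnerProductSpace ℂ (H j)]

lemma exists_clm_pair_tendsto_inner (U : Ultrafilter J) {x : ∀ j, E →ₗ[ℂ] H j}
    {y : ∀ j, F →ₗ[ℂ] H j} {K L : ℝ} (hx : ∀ j f, ‖x j f‖ ≤ K * ‖f‖)
    (hy : ∀ j g, ‖y j g‖ ≤ L * ‖g‖) :
    ∃ (X : E →L[ℂ] WithLp 2 (E × F)) (Y : F →L[ℂ] WithLp 2 (E × F)),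
      (∀ f c, (∀ j, ‖x j f‖ ≤ c) → ‖X f‖ ≤ c) ∧ (∀ g c, (∀ j, ‖y j g‖ ≤ c) → ‖Y g‖ ≤ c) ∧
      ∀ f g, Tendsto (fun j => ⟪y j g, x j f⟫_ℂ) U (𝓝 ⟪Y g, X f⟫_ℂ) := by
  let ofPair := (WithLp.prodContinuousLinearEquiv 2 ℂ E F).symm.toContinuousLinearMap
  let z (j : J) : WithLp 2 (E × F) →ₗ[ℂ] H j :=
    (x j).coprod (y j) ∘ₗ (WithLp.linearEquiv 2 ℂ (E × F)).toLinearMap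
  have z_left (j : J) (f : E) : z j (ofPair (f, 0)) = x j f := by simp [z, ofPair]
  have z_right (j : J) (g : F) : z j (ofPair (0, g)) = y j g := by simp [z, ofPair]
  have norm_z_le (j : J) (v : WithLp 2 (E × F)) : ‖z j v‖ ≤ (|K| + |L|) * ‖v‖ :=
    calc ‖x j v.fst + y j v.snd‖ ≤ ‖x j v.fst‖ + ‖y j v.snd‖ := norm_add_le _ _
      _ ≤ |K| * ‖v.fst‖ + |L| * ‖v.snd‖ := by
        grw [hx, hy, ← le_abs_self K, ← le_abs_self L]
      _ ≤ (|K| + |L|) * ‖v‖ := by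
        grw [add_mul, WithLp.norm_fst_le _ v, WithLp.norm_snd_le _ v]
  obtain ⟨Z, tendsto⟩ := exists_clm_tendsto_inner U norm_z_le
  refine ⟨Z ∘L ofPair ∘L .inl ℂ E F, Z ∘L ofPair ∘L .inr ℂ E F, fun f c hc => ?_,
    fun g c hc => ?_, fun f g => ?_⟩
  · exact norm_le_of_tendsto_inner_self (tendsto _ _) fun j => (z_left j f).symm ▸ hc j
  · exact norm_le_of_tendsto_inner_self (tendsto _ _) fun j => (z_right j g).symm ▸ hc j
  · have tendsto_pair := tendsto (ofPair (0, g)) (ofPair (f, 0))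
    simp only [z_left, z_right] at tendsto_pair
    exact tendsto_pair

end PairLimit

section Coding

variable {α : Type*} [MeasurableSpace α] (F : Finset {A : Set α // MeasurableSet A})

/-- The code of a point with respect to a finite family of measurable sets: the subfamily of the
members that contain it. The fibres of the code are the atoms of the family. -/
def setCode (a : α) : Set F := {A | a ∈ A.1.1}

lemma measurableSet_setCode_preimage_singleton (c : Set F) :
    MeasurableSet (setCode F ⁻¹' {c}) := by
  have : Measurable (setCode F) := measurable_set_iff.2 fun A => measurableSet_setOfPred.1 A.1.2
  exact this (measurableSet_singleton c)

end Coding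

section Limit

variable {S : Type u} {T : Type v} [MeasurableSpace S] [MeasurableSpace T]
  {m : Measure S} {n : Measure T} [IsFiniteMeasure m] [IsFiniteMeasure n]
  {Φ : S × T → ℂ} {C : ℝ≥0}

open Classical in
/-- On one grid, indicators of unions of cells see the exact rectangle integrals. -/
lemma HasGridFactorization.exists_gridMap (h : HasGridFactorization m n Φ C)
    (hΦ : Integrable Φ (m.prod n)) (F : Finset {A : Set S // MeasurableSet A})
    (G : Finset {B : Set T // MeasurableSet B}) :
    ∃ (x : Lp ℂ 2 m →ₗ[ℂ] EuclideanSpace ℂ (Set F ⊕ Set G))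
      (y : Lp ℂ 2 n →ₗ[ℂ] EuclideanSpace ℂ (Set F ⊕ Set G)),
      (∀ f, ‖x f‖ ≤ √C * ∫ s, ‖f s‖ ∂m) ∧ (∀ g, ‖y g‖ ≤ √C * ∫ t, ‖g t‖ ∂n) ∧
      ∀ A ∈ F, ∀ B ∈ G, ⟪y (indicatorConstLp 2 B.2 (measure_ne_top n _) 1),
          x (indicatorConstLp 2 A.2 (measure_ne_top m _) 1)⟫_ℂ
        = ∫ p in A.1 ×ˢ B.1, Φ p ∂(m.prod n) := by
  have cell_F := measurableSet_setCode_preimage_singleton F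
  have cell_G := measurableSet_setCode_preimage_singleton G
  have disjoint_F := pairwise_disjoint_fiber (setCode F)
  have disjoint_G := pairwise_disjoint_fiber (setCode G)
  obtain ⟨Ψ, ⟨w, norm_w, inner_w⟩, integral_Φ⟩ := h (Set F) (Set G) _ _ cell_F cell_G
    disjoint_F disjoint_G
  refine ⟨gridMap m cell_F fun i => w (.inl i), gridMap n cell_G fun j => w (.inr j),
    norm_gridMap_le cell_F disjoint_F fun _ => norm_w _,
    norm_gridMap_le cell_G disjoint_G fun _ => norm_w _, fun A hA B hB => ?_⟩
  let I : Finset (Set F) := {i | ⟨A, hA⟩ ∈ i}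
  let K : Finset (Set G) := {k | ⟨B, hB⟩ ∈ k}
  have A_eq : A.1 = ⋃ i ∈ I, setCode F ⁻¹' {i} := by ext; simp [I, setCode]
  have B_eq : B.1 = ⋃ k ∈ K, setCode G ⁻¹' {k} := by ext; simp [K, setCode]
  have prod_eq : A.1 ×ˢ B.1
      = ⋃ q ∈ I ×ˢ K, (setCode F ⁻¹' {q.1}) ×ˢ (setCode G ⁻¹' {q.2}) := by
    ext; simp [I, K, setCode]
  rw [gridMap_indicatorConstLp cell_F disjoint_F _ A.2 A_eq,
    gridMap_indicatorConstLp cell_G disjoint_G _ B.2 B_eq, prod_eq,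
    integral_biUnion_finset _ (fun q _ => (cell_F q.1).prod (cell_G q.2)) ?_
      (fun _ _ => hΦ.integrableOn), Finset.sum_product, inner_sum]
  · refine Finset.sum_congr rfl fun i _ => ?_
    rw [sum_inner]
    refine Finset.sum_congr rfl fun k _ => ?_
    rw [integral_Φ, inner_smul_left, inner_smul_right, Complex.conj_ofReal, inner_w]
    ring
  · intro q _ q' _ hq
    exact Set.disjoint_prod.2 <| (Prod.ext_iff.not.1 hq |> not_and_or.1).imp
      (fun h => disjoint_F h) fun h => disjoint_G h

lemma HasGridFactorization.exists_bilinear_factorization (h : HasGridFactorization m n Φ C)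
    (hΦ : Integrable Φ (m.prod n)) :
    ∃ (X : Lp ℂ 2 m →L[ℂ] WithLp 2 (Lp ℂ 2 m × Lp ℂ 2 n))
      (Y : Lp ℂ 2 n →L[ℂ] WithLp 2 (Lp ℂ 2 m × Lp ℂ 2 n)),
      (∀ f, ‖X f‖ ≤ √C * ∫ s, ‖f s‖ ∂m) ∧ (∀ g, ‖Y g‖ ≤ √C * ∫ t, ‖g t‖ ∂n) ∧
      ∀ A (hA : MeasurableSet A) B (hB : MeasurableSet B),
        ⟪Y (indicatorConstLp 2 hB (measure_ne_top n _) 1),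
          X (indicatorConstLp 2 hA (measure_ne_top m _) 1)⟫_ℂ
            = ∫ p in A ×ˢ B, Φ p ∂(m.prod n) := by
  let J := Finset {A : Set S // MeasurableSet A} × Finset {B : Set T // MeasurableSet B}
  choose x y norm_x norm_y inner_eq using fun j : J => h.exists_gridMap hΦ j.1 j.2
  let U : Ultrafilter J := .of atTop
  obtain ⟨X, Y, norm_X, norm_Y, tendsto⟩ := exists_clm_pair_tendsto_inner U
    (fun j f => ((norm_x j f).trans (mul_le_mul_of_nonneg_left (integral_norm_le_mul_norm m f)
      (Real.sqrt_nonneg _))).trans_eq (mul_assoc _ _ _).symm)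
    (fun j g => ((norm_y j g).trans (mul_le_mul_of_nonneg_left (integral_norm_le_mul_norm n g)
      (Real.sqrt_nonneg _))).trans_eq (mul_assoc _ _ _).symm)
  refine ⟨X, Y, fun f => norm_X f _ fun j => norm_x j f, fun g => norm_Y g _ fun j => norm_y j g,
    fun A hA B hB => tendsto_nhds_unique (tendsto _ _) (tendsto_const_nhds.congr' ?_)⟩
  refine Ultrafilter.of_le atTop ?_
  filter_upwards [eventually_ge_atTop (({⟨A, hA⟩}, {⟨B, hB⟩}) : J)] with j hj
  exact (inner_eq j ⟨A, hA⟩ (hj.1 (Finset.mem_singleton_self _)) ⟨B, hB⟩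
    (hj.2 (Finset.mem_singleton_self _))).symm

end Limit

end GridLimit

section OrthogonalExpansion

variable {𝕜 H : Type*} [RCLike 𝕜] [NormedAddCommGroup H] [InnerProductSpace 𝕜 H] [CompleteSpace H]

lemma hasSum_inner_mul_inner_of_mem_closure_span {ι : Type*} {v : ι → H} (hv : Orthonormal 𝕜 v)
    {a : H} (ha : a ∈ (Submodule.span 𝕜 (Set.range v)).topologicalClosure) (b : H) :
    HasSum (fun i => ⟪a, v i⟫_𝕜 * ⟪v i, b⟫_𝕜) ⟪a, b⟫_𝕜 := by
  let M := (Submodule.span 𝕜 (Set.range v)).topologicalClosure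
  have : CompleteSpace M := (Submodule.isClosed_topologicalClosure _).completeSpace_coe
  have v_mem (i : ι) : v i ∈ M := Submodule.le_topologicalClosure _ (Submodule.subset_span ⟨i, rfl⟩)
  have dense : (Submodule.span 𝕜 (Set.range fun i => (⟨v i, v_mem i⟩ : M)))ᗮ = ⊥ := by
    refine (Submodule.eq_bot_iff _).2 fun m hm => Subtype.ext ?_
    have span_le : Submodule.span 𝕜 (Set.range v) ≤ (𝕜 ∙ (m : H))ᗮ := by
      rw [Submodule.span_le, Set.range_subset_iff]
      exact fun i => Submodule.mem_orthogonal_singleton_iff_inner_left.2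
        ((Submodule.mem_orthogonal _ m).1 hm _ (Submodule.subset_span ⟨i, rfl⟩))
    exact inner_self_eq_zero.1 <| Submodule.mem_orthogonal_singleton_iff_inner_left.1 <|
      Submodule.topologicalClosure_minimal _ span_le (Submodule.isClosed_orthogonal _) m.2
  let basis := HilbertBasis.mkOfOrthogonalEqBot (hv.codRestrict M v_mem) dense
  have basis_apply (i : ι) : (basis i : H) = v i :=
    congrArg Subtype.val (congrFun (HilbertBasis.coe_mkOfOrthogonalEqBot _ dense) i)
  have expansion := basis.hasSum_inner_mul_inner ⟨a, ha⟩ (M.orthogonalProjectionOnto b)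
  simp only [Submodule.inner_orthogonalProjectionOnto_eq_of_mem_left] at expansion
  simpa only [Submodule.coe_inner, basis_apply] using expansion

lemma exists_isSuborthonormal_sequence {c : Set H} (hc : c.Countable) :
    ∃ u : ℕ → H, IsSuborthonormal 𝕜 u ∧ ∀ a ∈ (Submodule.span 𝕜 c).topologicalClosure, ∀ b,
      HasSum (fun n => ⟪a, u n⟫_𝕜 * ⟪u n, b⟫_𝕜) ⟪a, b⟫_𝕜 := by
  obtain ⟨v, hv⟩ := (hc.insert 0).exists_eq_range (Set.insert_nonempty _ _)
  let u : ℕ → H := InnerProductSpace.gramSchmidtNormed 𝕜 v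
  have orthonormal : Orthonormal 𝕜 fun i : {i | u i ≠ 0} => u i :=
    InnerProductSpace.gramSchmidtNormed_orthonormal' v
  have span_eq : Submodule.span 𝕜 c
      = Submodule.span 𝕜 (Set.range fun i : {i | u i ≠ 0} => u i) := by
    have range_eq : (Set.range fun i : {i | u i ≠ 0} => u i) = Set.range u \ {0} := by
      ext; aesop
    rw [range_eq, Submodule.span_sdiff_singleton_zero,
      InnerProductSpace.span_gramSchmidtNormed_range, InnerProductSpace.span_gramSchmidt, ← hv,
      Submodule.span_insert_zero]
  refine ⟨u, ⟨fun i j hij => ?_, fun i => ?_⟩, fun a ha b => ?_⟩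
  · simp only [u, InnerProductSpace.gramSchmidtNormed, inner_smul_left, inner_smul_right,
      InnerProductSpace.gramSchmidt_orthogonal 𝕜 v hij, mul_zero]
  · by_cases hi : u i = 0
    · simp only [hi, norm_zero, zero_le_one]
    · exact (InnerProductSpace.gramSchmidtNormed_unit_length' hi).le
  · refine (hasSum_subtype_iff_of_support_subset fun i hi => ?_).1
      (hasSum_inner_mul_inner_of_mem_closure_span orthonormal (span_eq ▸ ha) b)
    exact fun u_eq_zero => hi (by simp only [u_eq_zero, inner_zero_right, zero_mul])

end OrthogonalExpansion

section SeparableFactorization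

variable {𝕜 E F H ι : Type*} [RCLike 𝕜] [NormedAddCommGroup E] [InnerProductSpace 𝕜 E]
  [NormedAddCommGroup F] [InnerProductSpace 𝕜 F] [NormedAddCommGroup H] [InnerProductSpace 𝕜 H]

lemma apply_mem_closure_span_of_hilbertBasis (b : HilbertBasis ι 𝕜 F) (A : F →L[𝕜] H) (g : F) :
    A g ∈ (Submodule.span 𝕜 ((fun i => A (b i)) '' {i | A (b i) ≠ 0})).topologicalClosure := by
  let M := (Submodule.span 𝕜 ((fun i => A (b i)) '' {i | A (b i) ≠ 0})).topologicalClosure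
  have span_le : Submodule.span 𝕜 (Set.range b) ≤ M.comap A.toLinearMap := by
    rw [Submodule.span_le, Set.range_subset_iff]
    intro i
    by_cases hi : A (b i) = 0
    · exact (Submodule.mem_comap.2 (hi ▸ M.zero_mem) :)
    · exact Submodule.le_topologicalClosure _ (Submodule.subset_span ⟨i, hi, rfl⟩)
  have closure_le := Submodule.topologicalClosure_minimal _ span_le
    ((Submodule.isClosed_topologicalClosure _).preimage A.continuous)
  exact closure_le (b.dense_span ▸ Submodule.mem_top)

/-- Compressing `Y` to the closure of the range of `X` keeps the pairing and makes its range
separable. -/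
lemma exists_compression_hasSum_inner_mul_inner [CompleteSpace E] [CompleteSpace H]
    (X : E →L[𝕜] H) (Y : F →L[𝕜] H) (b : HilbertBasis ι 𝕜 F)
    (countable : {i | (X.adjoint ∘L Y) (b i) ≠ 0}.Countable) :
    ∃ (Y' : F →L[𝕜] H) (u : ℕ → H), IsSuborthonormal 𝕜 u ∧ (∀ g, ‖Y' g‖ ≤ ‖Y g‖) ∧
      ∀ f g, HasSum (fun k => ⟪Y' g, u k⟫_𝕜 * ⟪u k, X f⟫_𝕜) ⟪Y g, X f⟫_𝕜 := by
  let M := (LinearMap.range X.toLinearMap).topologicalClosure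
  have : CompleteSpace M := (Submodule.isClosed_topologicalClosure _).completeSpace_coe
  let Y' := M.starProjection ∘L Y
  have inner_Y' (f : E) (g : F) : ⟪Y' g, X f⟫_𝕜 = ⟪Y g, X f⟫_𝕜 := by
    have Xf_mem : X f ∈ M := Submodule.le_topologicalClosure _ ⟨f, rfl⟩
    exact (M.inner_starProjection_left_eq_right _ _).trans
      (congrArg (inner 𝕜 (Y g)) (Submodule.starProjection_eq_self_iff.2 Xf_mem))
  have Y'_eq_zero {g : F} (hg : (X.adjoint ∘L Y) g = 0) : Y' g = 0 := by
    have Yg_mem : Y g ∈ Mᗮ := by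
      rw [Submodule.orthogonal_closure, Submodule.mem_orthogonal]
      rintro _ ⟨f, rfl⟩
      exact (X.adjoint_inner_right f (Y g)).symm.trans (by
        rw [← ContinuousLinearMap.comp_apply, hg, inner_zero_right])
    exact M.starProjection_apply_eq_zero_iff.2 Yg_mem
  obtain ⟨u, suborthonormal, hasSum⟩ := exists_isSuborthonormal_sequence (𝕜 := 𝕜)
    ((countable.mono fun i hi => mt Y'_eq_zero hi).image fun i => Y' (b i))
  exact ⟨Y', u, suborthonormal, fun g => M.norm_starProjection_apply_le _, fun f g =>
    inner_Y' f g ▸ hasSum _ (apply_mem_closure_span_of_hilbertBasis b Y' g) (X f)⟩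

end SeparableFactorization

section TestFunctions

variable {α : Type*} [MeasurableSpace α] {m : Measure α} [IsFiniteMeasure m]

lemma eq_of_forall_inner_indicatorConstLp_eq {f g : Lp ℂ 2 m}
    (h : ∀ A (hA : MeasurableSet A), ⟪indicatorConstLp 2 hA (measure_ne_top m _) (1 : ℂ), f⟫_ℂ
      = ⟪indicatorConstLp 2 hA (measure_ne_top m _) (1 : ℂ), g⟫_ℂ) : f = g := by
  refine Lp.ext (Integrable.ae_eq_of_forall_setIntegral_eq _ _
    ((Lp.memLp f).integrable one_le_two) ((Lp.memLp g).integrable one_le_two) fun A hA _ => ?_)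
  simpa only [L2.inner_indicatorConstLp_one] using h A hA

lemma clm_eq_of_forall_inner_indicatorConstLp_eq {β : Type*} [MeasurableSpace β] {n : Measure β}
    [IsFiniteMeasure n] {D D' : Lp ℂ 2 n →L[ℂ] Lp ℂ 2 m}
    (h : ∀ A (hA : MeasurableSet A) B (hB : MeasurableSet B),
      ⟪indicatorConstLp 2 hA (measure_ne_top m _) (1 : ℂ),
        D (indicatorConstLp 2 hB (measure_ne_top n _) (1 : ℂ))⟫_ℂ
      = ⟪indicatorConstLp 2 hA (measure_ne_top m _) (1 : ℂ),
        D' (indicatorConstLp 2 hB (measure_ne_top n _) (1 : ℂ))⟫_ℂ) : D = D' := by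
  refine ContinuousLinearMap.adjoint.injective (ContinuousLinearMap.ext fun f => ?_)
  refine eq_of_forall_inner_indicatorConstLp_eq fun B hB => ?_
  rw [ContinuousLinearMap.adjoint_inner_right, ContinuousLinearMap.adjoint_inner_right,
    eq_of_forall_inner_indicatorConstLp_eq fun A hA => h A hA B hB]

lemma ae_norm_le_of_norm_inner_le {g : Lp ℂ 2 m} {K : ℝ} (hK : 0 ≤ K)
    (h : ∀ f : Lp ℂ 2 m, ‖⟪g, f⟫_ℂ‖ ≤ K * ∫ a, ‖f a‖ ∂m) : ∀ᵐ a ∂m, ‖g a‖ ≤ K := by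
  let A : Set α := {a | K < ‖g a‖}
  have hA : MeasurableSet A :=
    measurableSet_lt measurable_const (Lp.stronglyMeasurable g).norm.measurable
  have memLp : MemLp (A.indicator g) 2 m := (Lp.memLp g).indicator hA
  have coeFn := memLp.coeFn_toLp
  have integrable : Integrable (fun a => ‖g a‖) m := ((Lp.memLp g).integrable one_le_two).norm
  have integrable_sq : Integrable (fun a => ‖g a‖ ^ 2) m := 
    (Lp.memLp g).integrable_norm_pow two_ne_zero
  have inner_eq : ⟪g, memLp.toLp _⟫_ℂ = ((∫ a in A, ‖g a‖ ^ 2 ∂m : ℝ) : ℂ) := by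
    rw [L2.inner_def, ← integral_indicator hA, ← integral_complex_ofReal]
    refine integral_congr_ae (coeFn.mono fun a ha => ?_)
    by_cases haA : a ∈ A
    · simp only [ha, Set.indicator_of_mem haA, inner_self_eq_norm_sq_to_K,
        Complex.coe_algebraMap, Complex.ofReal_pow]
    · simp only [ha, Set.indicator_of_notMem haA, inner_zero_right, Complex.ofReal_zero]
  have norm_integral : ∫ a, ‖memLp.toLp _ a‖ ∂m = ∫ a in A, ‖g a‖ ∂m := by
    rw [← integral_indicator hA]
    exact integral_congr_ae (coeFn.mono fun a ha =>
      (congrArg norm ha).trans (norm_indicator_eq_indicator_norm _ _))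
  have le := h (memLp.toLp _)
  rw [inner_eq, norm_integral, Complex.norm_real,
    Real.norm_of_nonneg (integral_nonneg fun _ => sq_nonneg _)] at le
  have excess_nonneg : 0 ≤ᵐ[m.restrict A] fun a => ‖g a‖ ^ 2 - K * ‖g a‖ :=
    (ae_restrict_iff' hA).2 (.of_forall fun a (ha : K < ‖g a‖) => show 0 ≤ _ by nlinarith)
  have integral_excess : ∫ a in A, ‖g a‖ ^ 2 - K * ‖g a‖ ∂m = 0 := by
    refine (integral_nonneg_of_ae excess_nonneg).antisymm' ?_
    rw [integral_sub integrable_sq.integrableOn (integrable.integrableOn.const_mul K),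
      integral_const_mul]
    exact sub_nonpos.2 le
  rw [integral_eq_zero_iff_of_nonneg_ae excess_nonneg
    (integrable_sq.sub (integrable.const_mul K)).integrableOn, EventuallyEq,
    ae_restrict_iff' hA] at integral_excess
  filter_upwards [integral_excess] with a excess_eq_zero
  by_contra! lt
  exact absurd (excess_eq_zero lt) (show _ - _ ≠ (0 : ℝ) by nlinarith)

end TestFunctions

lemma ae_norm_le_of_forall_ae_norm_inner_le {α V : Type*} [MeasurableSpace α] {m : Measure α}
    [NormedAddCommGroup V] [InnerProductSpace ℂ V] [TopologicalSpace.SeparableSpace V]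
    {v : α → V} {K : ℝ} (hK : 0 ≤ K) (h : ∀ x, ∀ᵐ a ∂m, ‖⟪v a, x⟫_ℂ‖ ≤ K * ‖x‖) :
    ∀ᵐ a ∂m, ‖v a‖ ≤ K := by
  filter_upwards [ae_all_iff.2 fun k => h (TopologicalSpace.denseSeq V k)] with a ha
  rw [← innerSL_apply_norm ℂ]
  refine ContinuousLinearMap.opNorm_le_bound _ hK fun x => ?_
  exact (TopologicalSpace.denseRange_denseSeq V).induction_on x
    (isClosed_le (by fun_prop) (by fun_prop)) ha

lemma ae_tsum_enorm_adjoint_sq_le {α H : Type*} [MeasurableSpace α] {m : Measure α}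
    [IsFiniteMeasure m] [NormedAddCommGroup H] [InnerProductSpace ℂ H] [CompleteSpace H]
    {X : Lp ℂ 2 m →L[ℂ] H} {C : ℝ≥0} (hX : ∀ f, ‖X f‖ ≤ √C * ∫ a, ‖f a‖ ∂m) {u : ℕ → H}
    (hu : IsSuborthonormal ℂ u) : ∀ᵐ a ∂m, ∑' k, ‖X.adjoint (u k) a‖ₑ ^ 2 ≤ C := by
  have hu' {N : ℕ} : IsSuborthonormal ℂ fun i : Fin N => u i :=
    ⟨fun i j hij => hu.pairwise_inner (Fin.val_ne_of_ne hij), fun i => hu.norm_le_one i⟩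
  have norm_le (N : ℕ) : ∀ᵐ a ∂m,
      ‖WithLp.toLp 2 fun i : Fin N => starRingEnd ℂ (X.adjoint (u i) a)‖ ≤ √C := by
    refine ae_norm_le_of_forall_ae_norm_inner_le (Real.sqrt_nonneg _) fun z => ?_
    have combination_le : ‖∑ i : Fin N, z i • u i‖ ≤ ‖z‖ := by
      have sq_le := hu'.norm_sum_smul_sq_le Finset.univ z
      rw [← EuclideanSpace.norm_sq_eq] at sq_le
      exact (sq_le_sq₀ (norm_nonneg _) (norm_nonneg _)).1 sq_le
    have ae_le : ∀ᵐ a ∂m, ‖(∑ i : Fin N, z i • X.adjoint (u i) : Lp ℂ 2 m) a‖ ≤ √C * ‖z‖ := by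
      refine ae_norm_le_of_norm_inner_le (by positivity) fun f => ?_
      calc ‖⟪∑ i : Fin N, z i • X.adjoint (u i), f⟫_ℂ‖
          = ‖⟪∑ i : Fin N, z i • u i, X f⟫_ℂ‖ := by
            rw [← ContinuousLinearMap.adjoint_inner_left, map_sum]
            simp only [map_smul]
        _ ≤ ‖∑ i : Fin N, z i • u i‖ * ‖X f‖ := norm_inner_le_norm _ _
        _ ≤ ‖z‖ * (√C * ∫ a, ‖f a‖ ∂m) := by
            gcongr
            exact hX f
        _ = √C * ‖z‖ * ∫ a, ‖f a‖ ∂m := by ring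
    filter_upwards [ae_le, coeFn_sum_smul z fun i : Fin N => X.adjoint (u i)] with a le sum_apply
    rw [sum_apply] at le
    refine le_of_eq_of_le ?_ le
    simp [PiLp.inner_apply]
  filter_upwards [ae_all_iff.2 norm_le] with a ha
  rw [ENNReal.tsum_eq_iSup_nat]
  refine iSup_le fun N => ?_
  have sq_le := pow_le_pow_left₀ (norm_nonneg _) (ha N) 2
  simp only [EuclideanSpace.norm_sq_eq, RCLike.norm_conj, Real.sq_sqrt C.coe_nonneg,
    Fin.sum_univ_eq_sum_range (fun k => ‖X.adjoint (u k) a‖ ^ 2)] at sq_le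
  simp only [← ofReal_norm, ← ENNReal.ofReal_pow (norm_nonneg _)]
  rw [← ENNReal.ofReal_sum_of_nonneg fun _ _ => sq_nonneg _]
  exact (ENNReal.ofReal_le_ofReal sq_le).trans_eq ENNReal.ofReal_coe_nnreal

lemma kernelIntegral_eq_inner {S : Type u} {T : Type v} [MeasurableSpace T] {ν : Measure T}
    {h : S × T → ℂ} {s : S} (hs : MemLp (fun t => h (s, t)) 2 ν) (f : Lp ℂ 2 ν) :
    kernelIntegral ν h f s = ⟪hs.star.toLp _, f⟫_ℂ := by
  rw [L2.inner_def]
  refine integral_congr_ae (hs.star.coeFn_toLp.mono fun t ht => ?_)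
  simp only [ht, Pi.star_apply, RCLike.inner_apply, starRingEnd_apply, star_star, mul_comm]

section ProductMeasure

variable {S : Type u} {T : Type v} [MeasurableSpace S] [MeasurableSpace T]
  {μ : Measure S} {ν : Measure T}

lemma ae_eq_of_forall_setIntegral_prod_eq {Φ Ψ : S × T → ℂ}
    (hΦ : Integrable Φ (μ.prod ν)) (hΨ : Integrable Ψ (μ.prod ν))
    (h : ∀ A B, MeasurableSet A → MeasurableSet B →
      ∫ p in A ×ˢ B, Φ p ∂(μ.prod ν) = ∫ p in A ×ˢ B, Ψ p ∂(μ.prod ν)) :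
    Φ =ᵐ[μ.prod ν] Ψ := by
  have setIntegral_eq (E : Set (S × T)) (hE : MeasurableSet E) :
      ∫ p in E, Φ p ∂(μ.prod ν) = ∫ p in E, Ψ p ∂(μ.prod ν) := by
    induction E, hE using MeasurableSpace.induction_on_inter generateFrom_prod.symm
      isPiSystem_prod with
    | empty => simp only [setIntegral_empty]
    | basic E hE =>
      obtain ⟨A, hA, B, hB, rfl⟩ := hE
      exact h A B hA hB
    | compl E hE eq_E =>
      have eq_univ := h Set.univ Set.univ .univ .univ
      rw [Set.univ_prod_univ, setIntegral_univ, setIntegral_univ] at eq_univ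
      rw [setIntegral_compl hE hΦ, setIntegral_compl hE hΨ, eq_E, eq_univ]
    | iUnion f disjoint measurable eq_f =>
      rw [integral_iUnion measurable disjoint hΦ.integrableOn,
        integral_iUnion measurable disjoint hΨ.integrableOn]
      exact tsum_congr eq_f
  exact hΦ.ae_eq_of_forall_setIntegral_eq _ _ hΨ fun E hE _ => setIntegral_eq E hE

variable [SigmaFinite μ] [SigmaFinite ν]

lemma tsum_enorm_sq_integralOperator_hilbertBasis_le {h : S × T → ℂ}
    (hh : MemLp h 2 (μ.prod ν)) {ι : Type*} (b : HilbertBasis ι ℂ (Lp ℂ 2 ν)) :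
    ∑' i, ‖integralOperator h hh (b i)‖ₑ ^ 2 ≤ eLpNorm h 2 (μ.prod ν) ^ 2 := by
  rw [ENNReal.tsum_eq_iSup_sum]
  refine iSup_le fun F => ?_
  have enorm_sq (i : ι) : ‖integralOperator h hh (b i)‖ₑ ^ 2
      = ∫⁻ s, ‖kernelIntegral ν h (b i) s‖ₑ ^ 2 ∂μ := by
    rw [← eLpNorm_two_sq, ← Lp.enorm_toLp (kernelIntegral_memLp hh (Lp.memLp (b i)))]
    rfl
  simp only [enorm_sq]
  rw [← lintegral_finsetSum' _ fun i _ =>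
    (kernelIntegral_aestronglyMeasurable hh (Lp.memLp (b i))).enorm.pow_const 2,
    eLpNorm_two_sq, lintegral_prod _ (hh.1.enorm.pow_const 2)]
  refine lintegral_mono_ae ?_
  filter_upwards [kernel_section_memLp hh] with s hs
  simp only [kernelIntegral_eq_inner hs, enorm_inner_symm (hs.star.toLp _)]
  refine (ENNReal.sum_le_tsum F).trans_eq ?_
  rw [tsum_enorm_sq_inner_hilbertBasis, Lp.enorm_toLp, eLpNorm_two_sq]
  simp only [Pi.star_apply, ← starRingEnd_apply, RCLike.enorm_conj]

lemma countable_integralOperator_hilbertBasis_ne_zero {h : S × T → ℂ}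
    (hh : MemLp h 2 (μ.prod ν)) {ι : Type*} (b : HilbertBasis ι ℂ (Lp ℂ 2 ν)) :
    {i | integralOperator h hh (b i) ≠ 0}.Countable := by
  refine (Summable.countable_support_ennreal (ne_top_of_le_ne_top
    (ENNReal.pow_ne_top hh.2.ne) (tsum_enorm_sq_integralOperator_hilbertBasis_le hh b))).mono
    fun i hi => ?_
  exact pow_ne_zero 2 (enorm_ne_zero.2 hi)

end ProductMeasure

section ExpansionTransfer

variable {S : Type u} {T : Type v} [MeasurableSpace S] [MeasurableSpace T]

lemma norm_le_sqrt_of_tsum_enorm_sq_le {E ι : Type*} [NormedAddCommGroup E] {z : ι → E} {C : ℝ≥0}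
    (hz : ∑' k, ‖z k‖ₑ ^ 2 ≤ C) (k : ι) : ‖z k‖ ≤ NNReal.sqrt C := by
  have sq_le := (ENNReal.le_tsum k).trans hz
  rw [← coe_sqrt_sq, ENNReal.pow_le_pow_left_iff two_ne_zero] at sq_le
  exact enorm_le_coe.1 sq_le

lemma memLp_top_of_ae_tsum_enorm_sq_le {α : Type*} [MeasurableSpace α] {m : Measure α}
    {φ : ℕ → α → ℂ} {C : ℝ≥0} (φ_meas : ∀ k, AEStronglyMeasurable (φ k) m)
    (hφ : ∀ᵐ a ∂m, ∑' k, ‖φ k a‖ₑ ^ 2 ≤ C) (k : ℕ) : MemLp (φ k) ∞ m :=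
  memLp_top_of_bound (φ_meas k) (NNReal.sqrt C)
    (hφ.mono fun _ ha => norm_le_sqrt_of_tsum_enorm_sq_le ha k)

lemma IsBoundedExpansion.of_ae_le {μ : Measure S} {ν : Measure T} {φ : ℕ → S → ℂ} {ψ : ℕ → T → ℂ}
    {C : ℝ≥0} (φ_meas : ∀ k, AEStronglyMeasurable (φ k) μ)
    (ψ_meas : ∀ k, AEStronglyMeasurable (ψ k) ν) (hφ : ∀ᵐ s ∂μ, ∑' k, ‖φ k s‖ₑ ^ 2 ≤ C)
    (hψ : ∀ᵐ t ∂ν, ∑' k, ‖ψ k t‖ₑ ^ 2 ≤ C) :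
    IsBoundedExpansion μ ν (fun p => ∑' k, φ k p.1 * ψ k p.2) C φ ψ where
  left_memLp := memLp_top_of_ae_tsum_enorm_sq_le φ_meas hφ
  right_memLp := memLp_top_of_ae_tsum_enorm_sq_le ψ_meas hψ
  left_le := hφ
  right_le := hψ
  hasSum := by
    filter_upwards [Measure.quasiMeasurePreserving_fst.ae hφ,
      Measure.quasiMeasurePreserving_snd.ae hψ] with p left_le right_le
    refine (Summable.of_enorm ?_).hasSum
    simp only [enorm_mul]
    exact ((tsum_mul_le_of_tsum_sq_le left_le right_le).trans_lt ENNReal.coe_lt_top).ne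

lemma IsBoundedExpansion.congr {μ : Measure S} {ν : Measure T} {Φ Ψ : S × T → ℂ} {C : ℝ≥0}
    {φ : ℕ → S → ℂ} {ψ : ℕ → T → ℂ} (H : IsBoundedExpansion μ ν Φ C φ ψ)
    (h : Φ =ᵐ[μ.prod ν] Ψ) : IsBoundedExpansion μ ν Ψ C φ ψ where
  __ := H
  hasSum := by
    filter_upwards [H.hasSum, h] with p hasSum eq
    exact eq ▸ hasSum

lemma memLp_top_of_absolutelyContinuous {α E : Type*} [MeasurableSpace α] [NormedAddCommGroup E]
    {m m' : Measure α} (h : m ≪ m') {f : α → E} (hf : MemLp f ∞ m') : MemLp f ∞ m := by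
  refine ⟨hf.1.mono_ac h, ?_⟩
  rw [eLpNorm_exponent_top]
  exact (eLpNormEssSup_mono_measure f h).trans_lt (eLpNorm_exponent_top (f := f) ▸ hf.2)

lemma IsBoundedExpansion.of_absolutelyContinuous {μ μ' : Measure S} {ν ν' : Measure T} [SFinite ν']
    {Φ : S × T → ℂ} {C : ℝ≥0} {φ : ℕ → S → ℂ} {ψ : ℕ → T → ℂ}
    (H : IsBoundedExpansion μ' ν' Φ C φ ψ) (hμ : μ ≪ μ') (hν : ν ≪ ν') :
    IsBoundedExpansion μ ν Φ C φ ψ where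
  left_memLp k := memLp_top_of_absolutelyContinuous hμ (H.left_memLp k)
  right_memLp k := memLp_top_of_absolutelyContinuous hν (H.right_memLp k)
  hasSum := (hμ.prod hν).ae_le H.hasSum
  left_le := hμ.ae_le H.left_le
  right_le := hν.ae_le H.right_le

end ExpansionTransfer

section FiniteMeasure

variable {S : Type u} {T : Type v} [MeasurableSpace S] [MeasurableSpace T] {m : Measure S}
  {n : Measure T} [IsFiniteMeasure m] [IsFiniteMeasure n] {A : Set S} {B : Set T}

lemma inner_indicator_integralOperator_indicator {h : S × T → ℂ} (hh : MemLp h 2 (m.prod n))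
    (hA : MeasurableSet A) (hB : MeasurableSet B) :
    ⟪indicatorConstLp 2 hA (measure_ne_top m _) (1 : ℂ),
      integralOperator h hh (indicatorConstLp 2 hB (measure_ne_top n _) (1 : ℂ))⟫_ℂ
      = ∫ p in A ×ˢ B, h p ∂(m.prod n) := by
  rw [inner_integralOperator_of_ae_eq hh indicatorConstLp_coeFn indicatorConstLp_coeFn,
    ← integral_indicator (hA.prod hB)]
  refine integral_congr_ae (.of_forall fun p => ?_)
  by_cases p_fst : p.1 ∈ A <;> by_cases p_snd : p.2 ∈ B <;>
    simp [Set.indicator, Set.mem_prod, p_fst, p_snd]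

variable {H : Type*} [NormedAddCommGroup H] [InnerProductSpace ℂ H] [CompleteSpace H]
  {X : Lp ℂ 2 m →L[ℂ] H} {Y : Lp ℂ 2 n →L[ℂ] H} {Φ : S × T → ℂ}

lemma adjoint_comp_eq_integralOperator (hΦ : MemLp Φ 2 (m.prod n))
    (hXY : ∀ A (hA : MeasurableSet A) B (hB : MeasurableSet B),
      ⟪Y (indicatorConstLp 2 hB (measure_ne_top n _) 1),
        X (indicatorConstLp 2 hA (measure_ne_top m _) 1)⟫_ℂ = ∫ p in A ×ˢ B, Φ p ∂(m.prod n)) :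
    X.adjoint ∘L Y = integralOperator _ hΦ.star := by
  refine clm_eq_of_forall_inner_indicatorConstLp_eq fun A hA B hB => ?_
  rw [inner_indicator_integralOperator_indicator, ContinuousLinearMap.comp_apply,
    ContinuousLinearMap.adjoint_inner_right, ← inner_conj_symm, hXY A hA B hB, ← integral_conj]
  rfl

lemma setIntegral_prod_conj_mul (f : Lp ℂ 2 m) (g : Lp ℂ 2 n) (hA : MeasurableSet A)
    (hB : MeasurableSet B) :
    ∫ p in A ×ˢ B, starRingEnd ℂ (f p.1) * g p.2 ∂(m.prod n)
      = ⟪f, indicatorConstLp 2 hA (measure_ne_top m _) (1 : ℂ)⟫_ℂ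
        * ⟪indicatorConstLp 2 hB (measure_ne_top n _) (1 : ℂ), g⟫_ℂ := by
  rw [setIntegral_prod_mul (fun s => starRingEnd ℂ (f s)), integral_conj,
    ← L2.inner_indicatorConstLp_one hA (measure_ne_top m _),
    ← L2.inner_indicatorConstLp_one hB (measure_ne_top n _), inner_conj_symm]

lemma exists_isBoundedExpansion_of_factorization {C : ℝ≥0} (hΦ : MemLp Φ 2 (m.prod n))
    (hX : ∀ f, ‖X f‖ ≤ √C * ∫ s, ‖f s‖ ∂m) (hY : ∀ g, ‖Y g‖ ≤ √C * ∫ t, ‖g t‖ ∂n)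
    (hXY : ∀ A (hA : MeasurableSet A) B (hB : MeasurableSet B),
      ⟪Y (indicatorConstLp 2 hB (measure_ne_top n _) 1),
        X (indicatorConstLp 2 hA (measure_ne_top m _) 1)⟫_ℂ = ∫ p in A ×ˢ B, Φ p ∂(m.prod n)) :
    ∃ φ ψ, IsBoundedExpansion m n Φ C φ ψ := by
  have countable := countable_integralOperator_hilbertBasis_ne_zero hΦ.star (onb (Lp ℂ 2 n))
  rw [← adjoint_comp_eq_integralOperator hΦ hXY] at countable
  obtain ⟨Y', u, hu, Y'_le, hasSum⟩ := exists_compression_hasSum_inner_mul_inner X Y _ countable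
  let φ (k : ℕ) (s : S) := starRingEnd ℂ (X.adjoint (u k) s)
  let ψ (k : ℕ) (t : T) := Y'.adjoint (u k) t
  have φ_le : ∀ᵐ s ∂m, ∑' k, ‖φ k s‖ₑ ^ 2 ≤ C := by
    simpa only [φ, RCLike.enorm_conj] using ae_tsum_enorm_adjoint_sq_le hX hu
  have φ_meas (k : ℕ) : AEStronglyMeasurable (φ k) m := (Lp.memLp (X.adjoint (u k))).star.1
  have ψ_meas (k : ℕ) : AEStronglyMeasurable (ψ k) n := (Lp.memLp (Y'.adjoint (u k))).1
  have expansion := IsBoundedExpansion.of_ae_le φ_meas ψ_meas φ_le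
    (ae_tsum_enorm_adjoint_sq_le (fun g => (Y'_le g).trans (hY g)) hu)
  refine ⟨φ, ψ, expansion.congr (ae_eq_of_forall_setIntegral_prod_eq
    (expansion.memLp_top.integrable le_top) (hΦ.integrable one_le_two) fun A B hA hB => ?_)⟩
  have indicator_integrable : Integrable ((A ×ˢ B).indicator (1 : S × T → ℂ)) (m.prod n) :=
    (integrable_const 1).indicator (hA.prod hB)
  have integral_mul_indicator (F : S × T → ℂ) :
      ∫ p, F p * (A ×ˢ B).indicator 1 p ∂(m.prod n) = ∫ p in A ×ˢ B, F p ∂(m.prod n) := by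
    simp only [← Set.indicator_mul_right, Pi.one_apply, mul_one, integral_indicator (hA.prod hB)]
  have integral_hasSum := expansion.hasSum_integral indicator_integrable
  simp only [integral_mul_indicator] at integral_hasSum
  rw [← hXY A hA B hB]
  refine (integral_hasSum.congr_fun fun k => ?_).unique (hasSum _ _)
  rw [setIntegral_prod_conj_mul _ _ hA hB, ContinuousLinearMap.adjoint_inner_left,
    ContinuousLinearMap.adjoint_inner_right, mul_comm]

end FiniteMeasure

lemma HasBilinearBound.exists_isBoundedExpansion {S : Type u} {T : Type v} [MeasurableSpace S]
    [MeasurableSpace T] {μ : Measure S} {ν : Measure T} [SigmaFinite μ] [SigmaFinite ν]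
    {Φ : S × T → ℂ} {C : ℝ≥0} (hΦ : AEStronglyMeasurable Φ (μ.prod ν))
    (h : HasBilinearBound μ ν Φ C) : ∃ φ ψ, IsBoundedExpansion μ ν Φ C φ ψ := by
  obtain ⟨ρ, hρ, ρ_pos, _⟩ := exists_isFiniteMeasure_sqWeighted μ
  obtain ⟨θ, hθ, θ_pos, _⟩ := exists_isFiniteMeasure_sqWeighted ν
  have memLp : MemLp Φ 2 ((sqWeighted μ ρ).prod (sqWeighted ν θ)) := by
    rw [prod_sqWeighted hρ hθ]
    refine memLp_two_sqWeighted (by fun_prop) hΦ ?_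
    simpa only [NNReal.coe_mul, Complex.ofReal_mul] using
      (h _ _ (memLp_two_coe_of_isFiniteMeasure_sqWeighted hρ)
        (memLp_two_coe_of_isFiniteMeasure_sqWeighted hθ)).1
  obtain ⟨X, Y, hX, hY, hXY⟩ := (h.hasGridFactorization hρ hθ).exists_bilinear_factorization
    (memLp.integrable one_le_two)
  obtain ⟨φ, ψ, expansion⟩ := exists_isBoundedExpansion_of_factorization memLp hX hY hXY
  exact ⟨φ, ψ, expansion.of_absolutelyContinuous (absolutelyContinuous_sqWeighted hρ ρ_pos)
    (absolutelyContinuous_sqWeighted hθ θ_pos)⟩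

section Balancing

lemma exists_balancing_scalar {a b r : ℝ≥0} (hr : 0 < r) (hab : a * b ≤ r ^ 2) :
    ∃ t : ℝ≥0, t ≠ 0 ∧ t * a ≤ r ∧ t⁻¹ * b ≤ r := by
  rcases eq_or_ne a 0 with rfl | ha
  · refine ⟨b / r + 1, by positivity, by simp, ?_⟩
    rw [inv_mul_le_iff₀ (by positivity), add_mul, div_mul_cancel₀ _ hr.ne']
    exact le_self_add
  · refine ⟨r / a, by positivity, (div_mul_cancel₀ r ha).le, ?_⟩
    rwa [inv_div, div_mul_eq_mul_div, div_le_iff₀ hr, ← sq]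

lemma tsum_enorm_sq_const_mul_le {ι : Type*} {t a r : ℝ≥0} {z : ι → ℂ}
    (hz : ∑' k, ‖z k‖ₑ ^ 2 ≤ (a : ℝ≥0∞) ^ 2) (h : t * a ≤ r) :
    ∑' k, ‖(t : ℂ) * z k‖ₑ ^ 2 ≤ (r : ℝ≥0∞) ^ 2 := by
  have enorm_t : ‖(t : ℂ)‖ₑ = t := by simp [enorm]
  simp only [enorm_mul, mul_pow, enorm_t, ENNReal.tsum_mul_left]
  calc (t : ℝ≥0∞) ^ 2 * ∑' k, ‖z k‖ₑ ^ 2 ≤ (t : ℝ≥0∞) ^ 2 * (a : ℝ≥0∞) ^ 2 := by gcongr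
    _ = ((t * a : ℝ≥0) : ℝ≥0∞) ^ 2 := by rw [ENNReal.coe_mul, mul_pow]
    _ ≤ (r : ℝ≥0∞) ^ 2 := by gcongr

variable {S : Type u} {T : Type v} [MeasurableSpace S] [MeasurableSpace T]
  {μ : Measure S} {ν : Measure T} {Φ : S × T → ℂ} {C : ℝ≥0}

lemma exists_isBoundedExpansion_of_mul_le {φ : ℕ → S → ℂ} {ψ : ℕ → T → ℂ} {a b : ℝ≥0∞}
    (hC : 0 < C) (ha : a ≠ ∞) (hb : b ≠ ∞) (hab : a * b ≤ C)
    (φ_meas : ∀ k, AEStronglyMeasurable (φ k) μ) (ψ_meas : ∀ k, AEStronglyMeasurable (ψ k) ν)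
    (hasSum : ∀ᵐ p ∂(μ.prod ν), HasSum (fun k => φ k p.1 * ψ k p.2) (Φ p))
    (hφ : ∀ᵐ s ∂μ, ∑' k, ‖φ k s‖ₑ ^ 2 ≤ a ^ 2) (hψ : ∀ᵐ t ∂ν, ∑' k, ‖ψ k t‖ₑ ^ 2 ≤ b ^ 2) :
    ∃ φ' ψ', IsBoundedExpansion μ ν Φ C φ' ψ' := by
  lift a to ℝ≥0 using ha
  lift b to ℝ≥0 using hb
  obtain ⟨t, t_ne, ta_le, tb_le⟩ := exists_balancing_scalar (NNReal.sqrt_pos.2 hC)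
    (by rw [NNReal.sq_sqrt]; exact_mod_cast hab : a * b ≤ NNReal.sqrt C ^ 2)
  have left_le : ∀ᵐ s ∂μ, ∑' k, ‖(t : ℂ) * φ k s‖ₑ ^ 2 ≤ C :=
    hφ.mono fun s hs => (tsum_enorm_sq_const_mul_le hs ta_le).trans_eq (coe_sqrt_sq C)
  have right_le : ∀ᵐ y ∂ν, ∑' k, ‖((t⁻¹ : ℝ≥0) : ℂ) * ψ k y‖ₑ ^ 2 ≤ C :=
    hψ.mono fun y hy => (tsum_enorm_sq_const_mul_le hy tb_le).trans_eq (coe_sqrt_sq C)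
  refine ⟨_, _, (IsBoundedExpansion.of_ae_le (fun k => (φ_meas k).const_mul _)
    (fun k => (ψ_meas k).const_mul _) left_le right_le).congr ?_⟩
  filter_upwards [hasSum] with p hasSum_p
  rw [← hasSum_p.tsum_eq]
  refine tsum_congr fun k => ?_
  have coe_t_ne : (t : ℂ) ≠ 0 := by exact_mod_cast t_ne
  push_cast
  field_simp

end Balancing

section HilbertSpaceValued

open scoped lp

lemma memℓp_two_of_tsum_enorm_sq_ne_top {ι : Type*} {z : ι → ℂ} (hz : ∑' k, ‖z k‖ₑ ^ 2 ≠ ∞) :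
    Memℓp z 2 :=
  memℓp_gen (by simpa using ENNReal.summable_toReal hz)

lemma exists_aestronglyMeasurable_lp_two {α ι : Type*} [MeasurableSpace α] [Countable ι]
    {m : Measure α} {φ : ι → α → ℂ} (φ_meas : ∀ k, AEStronglyMeasurable (φ k) m)
    (hφ : ∀ᵐ a ∂m, ∑' k, ‖φ k a‖ₑ ^ 2 ≠ ∞) :
    ∃ x : α → ℓ²(ι, ℂ), AEStronglyMeasurable x m ∧ ∀ᵐ a ∂m, ∀ k, x a k = φ k a := by
  classical
  let x (a : α) : ℓ²(ι, ℂ) :=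
    if ha : ∑' k, ‖φ k a‖ₑ ^ 2 ≠ ∞ then ⟨_, memℓp_two_of_tsum_enorm_sq_ne_top ha⟩ else 0
  have x_apply : ∀ᵐ a ∂m, ∀ k, x a k = φ k a := hφ.mono fun a ha k => by simp only [x, dif_pos ha]
  refine ⟨x, aestronglyMeasurable_of_tendsto_ae (u := (atTop : Filter (Finset ι)))
    (f := fun F a => ∑ k ∈ F, φ k a • lp.single 2 k (1 : ℂ)) (fun F => ?_) ?_, x_apply⟩
  · exact Finset.aestronglyMeasurable_fun_sum _ fun k _ => (φ_meas k).smul_const _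
  · filter_upwards [x_apply] with a x_apply
    refine (lp.hasSum_single (by norm_num) (x a)).congr fun F => Finset.sum_congr rfl fun k _ => ?_
    rw [← lp.single_smul, smul_eq_mul, mul_one, ← x_apply]

lemma exists_lp_two_eLpNorm_top_le {α ι : Type*} [MeasurableSpace α] [Countable ι]
    {m : Measure α} {φ : ι → α → ℂ} {C : ℝ≥0} (φ_meas : ∀ k, AEStronglyMeasurable (φ k) m)
    (hφ : ∀ᵐ a ∂m, ∑' k, ‖φ k a‖ₑ ^ 2 ≤ C) :
    ∃ x : α → ℓ²(ι, ℂ), AEStronglyMeasurable x m ∧ (∀ᵐ a ∂m, ∀ k, x a k = φ k a) ∧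
      eLpNorm x ∞ m ≤ NNReal.sqrt C := by
  obtain ⟨x, x_meas, x_apply⟩ := exists_aestronglyMeasurable_lp_two φ_meas
    (hφ.mono fun _ ha => ne_top_of_le_ne_top ENNReal.coe_ne_top ha)
  refine ⟨x, x_meas, x_apply, ?_⟩
  rw [eLpNorm_exponent_top]
  refine essSup_le_of_ae_le _ ?_
  filter_upwards [x_apply, hφ] with a x_apply sum_le
  rw [← ENNReal.pow_le_pow_left_iff two_ne_zero, coe_sqrt_sq, enorm_lp_two_sq]
  simpa only [x_apply] using sum_le

variable {S : Type u} {T : Type v} [MeasurableSpace S] [MeasurableSpace T]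
  {μ : Measure S} {ν : Measure T} {Φ : S × T → ℂ} {C : ℝ≥0}

lemma IsBoundedExpansion.exists_inner {ι : Type*} (e : ι ≃ ℕ) {φ : ℕ → S → ℂ} {ψ : ℕ → T → ℂ}
    (H : IsBoundedExpansion μ ν Φ C φ ψ) :
    ∃ (x : S → ℓ²(ι, ℂ)) (y : T → ℓ²(ι, ℂ)), MemLp x ∞ μ ∧ MemLp y ∞ ν ∧
      (∀ᵐ p ∂(μ.prod ν), Φ p = ⟪y p.2, x p.1⟫_ℂ) ∧ eLpNorm x ∞ μ * eLpNorm y ∞ ν ≤ C := by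
  have : Countable ι := e.countable_iff.2 inferInstance
  obtain ⟨x, x_meas, x_apply, norm_x_le⟩ := exists_lp_two_eLpNorm_top_le
    (φ := fun k => φ (e k)) (C := C) (fun k => (H.left_memLp (e k)).1)
    (H.left_le.mono fun s hs => (e.tsum_eq fun n => ‖φ n s‖ₑ ^ 2).trans_le hs)
  obtain ⟨y, y_meas, y_apply, norm_y_le⟩ := exists_lp_two_eLpNorm_top_le
    (φ := fun k => star (ψ (e k))) (C := C) (fun k => (H.right_memLp (e k)).star.1) (by
      simp only [Pi.star_apply, RCLike.star_def, RCLike.enorm_conj]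
      exact H.right_le.mono fun t ht => (e.tsum_eq fun n => ‖ψ n t‖ₑ ^ 2).trans_le ht)
  refine ⟨x, y, ⟨x_meas, norm_x_le.trans_lt ENNReal.coe_lt_top⟩,
    ⟨y_meas, norm_y_le.trans_lt ENNReal.coe_lt_top⟩, ?_,
    (mul_le_mul' norm_x_le norm_y_le).trans_eq (by rw [← sq, coe_sqrt_sq])⟩
  filter_upwards [H.hasSum, Measure.quasiMeasurePreserving_fst.ae x_apply,
    Measure.quasiMeasurePreserving_snd.ae y_apply] with p hasSum x_apply y_apply
  refine (e.hasSum_iff.2 hasSum).unique ((lp.hasSum_inner (y p.2) (x p.1)).congr_fun fun k => ?_)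
  rw [x_apply, y_apply, RCLike.inner_apply, Pi.star_apply, RCLike.star_def, RCLike.conj_conj,
    comp_apply]

/-- The essential range of `x` is separable, so a suborthonormal sequence expands the inner
products with the values of `x`. -/
lemma exists_isBoundedExpansion_of_inner {H : Type*} [NormedAddCommGroup H]
    [InnerProductSpace ℂ H] [CompleteSpace H] {x : S → H} {y : T → H} (hC : 0 < C)
    (hx : MemLp x ∞ μ) (hy : MemLp y ∞ ν) (hΦ : ∀ᵐ p ∂(μ.prod ν), Φ p = ⟪y p.2, x p.1⟫_ℂ)
    (hle : eLpNorm x ∞ μ * eLpNorm y ∞ ν ≤ C) : ∃ φ ψ, IsBoundedExpansion μ ν Φ C φ ψ := by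
  obtain ⟨c, c_countable, range_subset⟩ := hx.1.stronglyMeasurable_mk.isSeparable_range
  obtain ⟨u, hu, expansion⟩ := exists_isSuborthonormal_sequence (𝕜 := ℂ) c_countable
  have sum_sq_le {a : H} {r : ℝ≥0∞} (ha : ‖a‖ₑ ≤ r) : ∑' k, ‖⟪u k, a⟫_ℂ‖ₑ ^ 2 ≤ r ^ 2 :=
    (hu.tsum_enorm_inner_sq_le a).trans (pow_le_pow_left' ha 2)
  refine exists_isBoundedExpansion_of_mul_le (φ := fun k s => ⟪u k, x s⟫_ℂ)
    (ψ := fun k t => ⟪y t, u k⟫_ℂ) hC hx.2.ne hy.2.ne hle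
    (fun k => aestronglyMeasurable_const.inner hx.1)
    (fun k => hy.1.inner aestronglyMeasurable_const) ?_ ?_ ?_
  · filter_upwards [hΦ, Measure.quasiMeasurePreserving_fst.ae hx.1.ae_eq_mk] with p Φ_apply x_eq
    have mem_closure : x p.1 ∈ (Submodule.span ℂ c).topologicalClosure := by
      rw [x_eq]
      exact closure_mono Submodule.subset_span (range_subset ⟨p.1, rfl⟩)
    have hasSum := Complex.hasSum_conj'.2 (expansion _ mem_closure (y p.2))
    rw [inner_conj_symm, ← Φ_apply] at hasSum
    refine hasSum.congr_fun fun k => ?_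
    rw [map_mul, inner_conj_symm, inner_conj_symm]
  · filter_upwards [enorm_ae_le_eLpNormEssSup x μ] with s hs
    exact sum_sq_le (hs.trans_eq eLpNorm_exponent_top.symm)
  · filter_upwards [enorm_ae_le_eLpNormEssSup y ν] with t ht
    simp only [enorm_inner_symm (y t)]
    exact sum_sq_le (ht.trans_eq eLpNorm_exponent_top.symm)

end HilbertSpaceValued

section HaagerupNorm

variable {S : Type u} {T : Type v} [MeasurableSpace S] [MeasurableSpace T]
  {μ : Measure S} {ν : Measure T} {Φ : S × T → ℂ} {C : ℝ≥0} {φ : ℕ → S → ℂ} {ψ : ℕ → T → ℂ}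

lemma ae_tsum_enorm_sq_le_normLinftyEllTwo_sq (μ : Measure S) (φ : ℕ → S → ℂ) :
    ∀ᵐ s ∂μ, ∑' k, ‖φ k s‖ₑ ^ 2 ≤ normLinftyEllTwo μ φ ^ 2 := by
  rw [normLinftyEllTwo, sq_rpow_half]
  exact ae_le_essSup

lemma normLinftyEllTwo_le_sqrt (h : ∀ᵐ s ∂μ, ∑' k, ‖φ k s‖ₑ ^ 2 ≤ C) :
    normLinftyEllTwo μ φ ≤ NNReal.sqrt C := by
  rw [← ENNReal.pow_le_pow_left_iff two_ne_zero, coe_sqrt_sq, normLinftyEllTwo, sq_rpow_half]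
  exact essSup_le_of_ae_le _ h

lemma IsBoundedExpansion.isHaagerupRepresentation (H : IsBoundedExpansion μ ν Φ C φ ψ) :
    IsHaagerupRepresentation μ ν Φ φ ψ where
  left_memLp := H.left_memLp
  right_memLp := H.right_memLp
  left_finite := (normLinftyEllTwo_le_sqrt H.left_le).trans_lt ENNReal.coe_lt_top
  right_finite := (normLinftyEllTwo_le_sqrt H.right_le).trans_lt ENNReal.coe_lt_top
  hasSum := H.hasSum

lemma IsHaagerupRepresentation.haagerupNorm_le (h : IsHaagerupRepresentation μ ν Φ φ ψ) :
    haagerupNorm μ ν Φ ≤ normLinftyEllTwo μ φ * normLinftyEllTwo ν ψ :=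
  iInf_le_of_le φ (iInf₂_le ψ h)

lemma IsBoundedExpansion.haagerupNorm_le (H : IsBoundedExpansion μ ν Φ C φ ψ) :
    haagerupNorm μ ν Φ ≤ C :=
  calc haagerupNorm μ ν Φ ≤ normLinftyEllTwo μ φ * normLinftyEllTwo ν ψ :=
        H.isHaagerupRepresentation.haagerupNorm_le
    _ ≤ NNReal.sqrt C * NNReal.sqrt C :=
        mul_le_mul' (normLinftyEllTwo_le_sqrt H.left_le) (normLinftyEllTwo_le_sqrt H.right_le)
    _ = C := by rw [← sq, coe_sqrt_sq]

lemma exists_isBoundedExpansion_of_haagerupNorm_lt (h : haagerupNorm μ ν Φ < C) :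
    ∃ φ ψ, IsBoundedExpansion μ ν Φ C φ ψ := by
  simp only [haagerupNorm, iInf_lt_iff] at h
  obtain ⟨φ, ψ, rep, mul_lt⟩ := h
  exact exists_isBoundedExpansion_of_mul_le (ENNReal.coe_pos.1 (zero_le.trans_lt mul_lt))
    rep.left_finite.ne rep.right_finite.ne mul_lt.le (fun k => (rep.left_memLp k).1)
    (fun k => (rep.right_memLp k).1) rep.hasSum (ae_tsum_enorm_sq_le_normLinftyEllTwo_sq μ φ)
    (ae_tsum_enorm_sq_le_normLinftyEllTwo_sq ν ψ)

lemma memHaagerup_iff_exists_isBoundedExpansion :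
    MemHaagerup μ ν Φ ↔ ∃ C φ ψ, IsBoundedExpansion μ ν Φ C φ ψ := by
  refine ⟨fun ⟨φ, ψ, rep⟩ => ?_, fun ⟨C, φ, ψ, H⟩ => ⟨φ, ψ, H.isHaagerupRepresentation⟩⟩
  obtain ⟨C, haagerupNorm_lt, -⟩ := ENNReal.lt_iff_exists_nnreal_btwn.1
    (rep.haagerupNorm_le.trans_lt (ENNReal.mul_lt_top rep.left_finite rep.right_finite))
  exact ⟨C, exists_isBoundedExpansion_of_haagerupNorm_lt haagerupNorm_lt⟩

end HaagerupNorm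

section SchurNorm

variable {S : Type u} {T : Type v} [MeasurableSpace S] [MeasurableSpace T]
  {μ : Measure S} {ν : Measure T} [SigmaFinite μ] [SigmaFinite ν] {Φ : S × T → ℂ} {C : ℝ≥0}

lemma exists_isSchurBound_of_schurNorm_lt {r : ℝ≥0∞} (h : schurNorm μ ν Φ < r) :
    ∃ c : ℝ≥0, IsSchurBound μ ν Φ c ∧ c < r := by
  simpa only [schurNorm, iInf_lt_iff, exists_prop] using h

lemma hasBilinearBound_of_schurNorm_le (h : schurNorm μ ν Φ ≤ C) : HasBilinearBound μ ν Φ C := by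
  intro a c ha hc
  refine ⟨?_, fun b hb => ?_⟩
  · obtain ⟨B, hB, -⟩ := exists_isSchurBound_of_schurNorm_lt (h.trans_lt ENNReal.coe_lt_top)
    exact (hB.hasBilinearBound a c ha hc).1
  · have norm_mul_ne_top := ENNReal.mul_ne_top ha.2.ne hc.2.ne
    have tendsto_mul : Tendsto (fun r : ℝ≥0∞ => r * (eLpNorm a 2 μ * eLpNorm c 2 ν)) (𝓝[>] C)
        (𝓝 (C * (eLpNorm a 2 μ * eLpNorm c 2 ν))) :=
      (ENNReal.continuous_mul_const norm_mul_ne_top).continuousWithinAt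
    have : (𝓝[>] (C : ℝ≥0∞)).NeBot := nhdsGT_neBot_of_exists_gt ⟨∞, ENNReal.coe_lt_top⟩
    refine ge_of_tendsto tendsto_mul (eventually_mem_nhdsWithin.mono fun r hr => ?_)
    obtain ⟨B, hB, B_lt⟩ := exists_isSchurBound_of_schurNorm_lt (h.trans_lt hr)
    exact ((hB.hasBilinearBound a c ha hc).2 b hb).trans (by gcongr)

lemma exists_isBoundedExpansion_iff :
    (∃ φ ψ, IsBoundedExpansion μ ν Φ C φ ψ) ↔ IsSchurMultiplier μ ν Φ ∧ schurNorm μ ν Φ ≤ C :=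
  ⟨fun ⟨_, _, H⟩ => ⟨H.isSchurMultiplier, iInf₂_le C H.isSchurBound⟩, fun ⟨schur, schurNorm_le⟩ =>
    (hasBilinearBound_of_schurNorm_le schurNorm_le).exists_isBoundedExpansion schur.1⟩

lemma isSchurMultiplier_iff_memHaagerup : IsSchurMultiplier μ ν Φ ↔ MemHaagerup μ ν Φ := by
  rw [memHaagerup_iff_exists_isBoundedExpansion]
  refine ⟨fun h => ?_, fun ⟨_, _, _, H⟩ => H.isSchurMultiplier⟩
  exact h.exists_hasBilinearBound.imp fun C hC => hC.exists_isBoundedExpansion h.1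

lemma IsSchurMultiplier.schurNorm_eq_haagerupNorm (h : IsSchurMultiplier μ ν Φ) :
    schurNorm μ ν Φ = haagerupNorm μ ν Φ := by
  apply le_antisymm
  · refine le_of_forall_gt_imp_ge_of_dense fun r hr => ?_
    obtain ⟨C, haagerupNorm_lt, C_lt⟩ := ENNReal.lt_iff_exists_nnreal_btwn.1 hr
    refine le_trans ?_ C_lt.le
    exact (exists_isBoundedExpansion_iff.1
      (exists_isBoundedExpansion_of_haagerupNorm_lt haagerupNorm_lt)).2
  · refine le_iInf₂ fun C hC => ?_
    obtain ⟨φ, ψ, H⟩ := hC.hasBilinearBound.exists_isBoundedExpansion h.1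
    exact H.haagerupNorm_le

end SchurNorm

theorem mainTheorem1_general {S : Type u} {T : Type v} [MeasurableSpace S] [MeasurableSpace T]
    (μ : Measure S) (ν : Measure T) [SigmaFinite μ] [SigmaFinite ν] :
    (∀ (Φ : S × T → ℂ) (C : ℝ), 0 < C →
      List.TFAE [
        IsSchurMultiplier μ ν Φ ∧ schurNorm μ ν Φ ≤ ENNReal.ofReal C,
        ∃ (H : Type w) (_ : NormedAddCommGroup H) (_ : InnerProductSpace ℂ H)
          (_ : CompleteSpace H) (x : S → H) (y : T → H),
          MemLp x ∞ μ ∧ MemLp y ∞ ν ∧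
          (∀ᵐ p ∂(μ.prod ν), Φ p = inner ℂ (y p.2) (x p.1)) ∧
          eLpNorm x ∞ μ * eLpNorm y ∞ ν ≤ ENNReal.ofReal C,
        ∃ (φ : ℕ → S → ℂ) (ψ : ℕ → T → ℂ),
          (∀ n, MemLp (φ n) ∞ μ) ∧ (∀ n, MemLp (ψ n) ∞ ν) ∧
          (∀ᵐ p ∂(μ.prod ν), HasSum (fun n => φ n p.1 * ψ n p.2) (Φ p)) ∧
          (∀ᵐ s ∂μ, ∑' n, ‖φ n s‖ₑ ^ 2 ≤ ENNReal.ofReal C) ∧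
          (∀ᵐ t ∂ν, ∑' n, ‖ψ n t‖ₑ ^ 2 ≤ ENNReal.ofReal C)]) ∧
    (∀ (Φ : S × T → ℂ),
      (IsSchurMultiplier μ ν Φ ↔ MemHaagerup μ ν Φ) ∧
      (IsSchurMultiplier μ ν Φ → schurNorm μ ν Φ = haagerupNorm μ ν Φ)) := by
  refine ⟨fun Φ C hC => ?_, fun Φ => ⟨isSchurMultiplier_iff_memHaagerup,
    IsSchurMultiplier.schurNorm_eq_haagerupNorm⟩⟩
  tfae_have 1 → 3 := fun h => by
    obtain ⟨φ, ψ, H⟩ := exists_isBoundedExpansion_iff.2 h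
    exact ⟨φ, ψ, H.left_memLp, H.right_memLp, H.hasSum, H.left_le, H.right_le⟩
  tfae_have 3 → 1 := fun ⟨φ, ψ, hφ, hψ, hasSum, left_le, right_le⟩ =>
    exists_isBoundedExpansion_iff.1 ⟨φ, ψ, hφ, hψ, hasSum, left_le, right_le⟩
  tfae_have 3 → 2 := fun ⟨φ, ψ, hφ, hψ, hasSum, left_le, right_le⟩ =>
    have H : IsBoundedExpansion μ ν Φ C.toNNReal φ ψ := ⟨hφ, hψ, hasSum, left_le, right_le⟩
    ⟨_, _, _, inferInstance, H.exists_inner (Equiv.ulift.{w} (α := ℕ))⟩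
  tfae_have 2 → 3 := fun ⟨H, _, _, _, x, y, hx, hy, hΦ, norm_le⟩ => by
    obtain ⟨φ, ψ, H⟩ :=
      exists_isBoundedExpansion_of_inner (Real.toNNReal_pos.2 hC) hx hy hΦ norm_le
    exact ⟨φ, ψ, H.left_memLp, H.right_memLp, H.hasSum, H.left_le, H.right_le⟩
  tfae_finish

theorem mainTheorem1 {S : Type u} {T : Type v} [MeasurableSpace S] [MeasurableSpace T]
    (μ : Measure S) (ν : Measure T) [SigmaFinite μ] [SigmaFinite ν] :
    (∀ (Φ : S × T → ℂ), MemLp Φ ∞ (μ.prod ν) → ∀ (C : ℝ), 0 < C →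
      List.TFAE [
        IsSchurMultiplier μ ν Φ ∧ schurNorm μ ν Φ ≤ ENNReal.ofReal C,
        ∃ (H : Type w) (_ : NormedAddCommGroup H) (_ : InnerProductSpace ℂ H)
          (_ : CompleteSpace H) (x : S → H) (y : T → H),
          MemLp x ∞ μ ∧ MemLp y ∞ ν ∧
          (∀ᵐ p ∂(μ.prod ν), Φ p = inner ℂ (y p.2) (x p.1)) ∧
          eLpNorm x ∞ μ * eLpNorm y ∞ ν ≤ ENNReal.ofReal C,
        ∃ (φ : ℕ → S → ℂ) (ψ : ℕ → T → ℂ),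
          (∀ n, MemLp (φ n) ∞ μ) ∧ (∀ n, MemLp (ψ n) ∞ ν) ∧
          (∀ᵐ p ∂(μ.prod ν), HasSum (fun n => φ n p.1 * ψ n p.2) (Φ p)) ∧
          (∀ᵐ s ∂μ, ∑' n, ‖φ n s‖ₑ ^ 2 ≤ ENNReal.ofReal C) ∧
          (∀ᵐ t ∂ν, ∑' n, ‖ψ n t‖ₑ ^ 2 ≤ ENNReal.ofReal C)]) ∧
    (∀ (Φ : S × T → ℂ),
      (IsSchurMultiplier μ ν Φ ↔ MemHaagerup μ ν Φ) ∧
      (IsSchurMultiplier μ ν Φ → schurNorm μ ν Φ = haagerupNorm μ ν Φ)) :=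
  ⟨fun Φ _ => (mainTheorem1_general μ ν).1 Φ, (mainTheorem1_general.{u, v, w} μ ν).2⟩
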